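/- **Spaces and fans.** Let $d\ge 0$ be an integer and $[n]=\{1,\dots,n\}$. Let $V_d=\{x\in\mathbb R^{d+1}:\sum_i x_i=0\}$, let $W_d=\mathbb R^{d+1}/\mathbb R(1,\dots,1)$ (paired with $V_d$ by the dot product), and for $\alpha\in\mathbb R^{d+1}$ let $U_d^{\alpha}=\{x\in\mathbb R^{d+1}:\sum_i x_i=\sum_i\alpha_i\}$. For a polytope $P$ in a translate of $V_d$ and a nonempty face $F$ of $P$ (the set of maximizers over $P$ of a linear functional), let $\operatorname{ncone}(F,P)=\{w\in W_d:\langle w,y-y'\rangle\ge 0\ \ \forall y\in F,\ y'\in P\}$; the normal fan of $P$ is the set of the cones $\operatorname{ncone}(F,P)$ over all nonempty faces $F$. A fan in $W_d$ is a finite set of polyhedral cones that contains all nonempty faces of its members and in which any two members intersect in a common face. It is complete if its union is $W_d$, and projective if it is the normal fan of a nonempty polytope in a translate of $V_d$. **Trees.** Let $\mathscr T_n$ be the set of plane rooted trees with $n+1$ leaves in which each internal vertex has at least two children, and $\mathscr T_{n,n}\subseteq\mathscr T_n$ the set of those with $n$ internal vertices (the complete binary trees). If $\ell_1,\dots,\ell_{n+1}$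 are the leaves of $\mathrm T\in\mathscr T_n$ from left to right, the closest common ancestor of $\ell_i$ and $\ell_{i+1}$ gets the label $i$; an internal vertex may have several labels. Write $i\preceq_{\mathrm T}j$ if the vertex labeled $j$ is an ancestor of, or equal to, the vertex labeled $i$; this is a preorder on $[n]$. For $\mathrm T\in\mathscr T_{d,d}$ and $\beta\in\mathbb R^d$ put $\beta_{\mathrm T,i}=\sum_{k=1}^{t}\beta_k-\sum_{k=1}^{a}\beta_k-\sum_{k=1}^{b}\beta_k$, where $t,a,b$ are the numbers of internal vertices of the subtree rooted at the vertex labeled $i$, of its left subtree and of its right subtree. **Points.** For $\pi\in\mathfrak S_{d+1}$, $\mathrm T\in\mathscr T_{d,d}$, $\alpha\in\mathbb R^{d+1}$, $\beta\in\mathbb R^d$, let $$v_{\pi,\mathrm T}=\sum_{i=1}^{d+1}\alpha_i e_{\pi^{-1}(i)}+\sum_{i=1}^{d}\beta_{\mathrm T,i}\bigl(e_{\pi^{-1}(i+1)}-e_{\pi^{-1}(i)}\bigr).$$ The pair $(\alpha,\beta)$ is $\mathscr T$-appropriate if $\alpha$ and $\beta$ are strictly increasing and, for every $\mathrm T\in\mathscr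 T_{d,d}$, the coefficient $\alpha_i+\beta_{\mathrm T,i-1}-\beta_{\mathrm T,i}$ of $e_{\pi^{-1}(i)}$ in $v_{\pi,\mathrm T}$ is strictly increasing in $i$ (with $\beta_{\mathrm T,0}=\beta_{\mathrm T,d+1}=0$). In that case let $\operatorname{PermAsso}(\alpha,\beta)$ be the convex hull of all $v_{\pi,\mathrm T}$, $(\pi,\mathrm T)\in\mathfrak S_{d+1}\times\mathscr T_{d,d}$. **Cones.** Let $\mathscr P_d$ be the set of pairs $(\mathcal S,\mathrm T)$ where $\mathcal S=(S_1,\dots,S_k)$ is an ordered partition of $[d+1]$ into $k\ge1$ nonempty blocks and $\mathrm T\in\mathscr T_{k-1}$. Put $t_a=|S_1|+\dots+|S_a|$ and $\operatorname{Type}(\mathcal S)=\{t_1,\dots,t_{k-1}\}$, and let $\preceq_{(\mathcal S,\mathrm T)}$ be the preorder on $\operatorname{Type}(\mathcal S)$ with $t_a\preceq_{(\mathcal S,\mathrm T)} t_b$ if and only if $a\preceq_{\mathrm T}b$. Choose $\pi\in\mathfrak S_{d+1}$ such that $\mathcal S(\pi)=(\{\pi^{-1}(1)\},\dots,\{\pi^{-1}(d+1)\})$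 refines $\mathcal S$ (as ordered partitions), and put $\mathrm D^\pi_i w=w_{\pi^{-1}(i+1)}-w_{\pi^{-1}(i)}$. Then $\sigma(\mathcal S,\mathrm T)$ is the set of those $w\in W_d$ such that $w_i=w_j$ whenever $i,j$ lie in the same block of $\mathcal S$, $\mathrm D^\pi_i w\le\mathrm D^\pi_j w$ whenever $i\preceq_{(\mathcal S,\mathrm T)}j$, and $\mathrm D^\pi_\ell w\ge0$ for each minimal element $\ell$ of $\preceq_{(\mathcal S,\mathrm T)}$; this does not depend on the choice of $\pi$. Write $\sigma(\pi,\mathrm T)=\sigma(\mathcal S(\pi),\mathrm T)$ for $(\pi,\mathrm T)\in\mathfrak S_{d+1}\times\mathscr T_{d,d}$, and $\Xi_d=\{\sigma(\mathcal S,\mathrm T):(\mathcal S,\mathrm T)\in\mathscr P_d\}$ (the nested Loday fan). **Proposition.** Let $(\alpha,\beta)\in\mathbb R^{d+1}\times\mathbb R^d$ be a $\mathscr T$-appropriate pair. 1. $\operatorname{PermAsso}(\alpha,\beta)$ is full-dimensional in $U_d^\alpha$ (its affine hull is $U_d^{\alpha}$), and its vertex set is $\{v_{\pi,\mathrm T}:(\pi,\mathrm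 T)\in\mathfrak S_{d+1}\times\mathscr T_{d,d}\}$. 2. For each $(\pi,\mathrm T)\in\mathfrak S_{d+1}\times\mathscr T_{d,d}$, $\sigma(\pi,\mathrm T)=\operatorname{ncone}(v_{\pi,\mathrm T},\operatorname{PermAsso}(\alpha,\beta))$. 3. The normal fan of $\operatorname{PermAsso}(\alpha,\beta)$ is $\Xi_d$. Hence $\Xi_d$ is a complete projective fan in $W_d$. -/

import Mathlib

noncomputable section

namespace NestedPermAsso

/-! ### Faces, vertices, cones, fans -/

section Polyhedral

variable {E : Type*} [AddCommGroup E] [Module ℝ E]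

/-- `F` is a nonempty face of `P`: the nonempty set of maximizers over `P` of a linear
functional. -/
def IsNonemptyFace (P F : Set E) : Prop :=
  F.Nonempty ∧ ∃ l : Module.Dual ℝ E, F = {x | x ∈ P ∧ ∀ y ∈ P, l y ≤ l x}

/-- The vertices of `P`: the points `v` such that `{v}` is a face of `P`. -/
def vertexSet (P : Set E) : Set E := {v | IsNonemptyFace P {v}}

/-- A polyhedral cone: the solution set of finitely many homogeneous linear inequalities. -/
def IsPolyhedralCone (C : Set E) : Prop :=
  ∃ A : Finset (Module.Dual ℝ E), C = {w | ∀ l ∈ A, 0 ≤ l w}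

/-- A (polyhedral) fan: a finite collection of polyhedral cones that contains every nonempty face
of each of its members, and in which the intersection of two members is a face of both. -/
structure IsFan (Fan : Set (Set E)) : Prop where
  finite : Fan.Finite
  polyhedral : ∀ C ∈ Fan, IsPolyhedralCone C
  face_mem : ∀ C ∈ Fan, ∀ F, IsNonemptyFace C F → F ∈ Fan
  inter_face : ∀ C ∈ Fan, ∀ C' ∈ Fan, IsNonemptyFace C (C ∩ C') ∧ IsNonemptyFace C' (C ∩ C')

/-- A collection of cones is complete if its union is the whole space. -/
def IsCompleteFan (Fan : Set (Set E)) : Prop := ⋃₀ Fan = Set.univ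

end Polyhedral

/-! ### The spaces `V_d`, `W_d`, `U_d^α` and normal fans -/

/-- `V_d`: the vectors of `ℝ^(d+1)` with coordinate sum zero. -/
def V (d : ℕ) : Submodule ℝ (Fin (d + 1) → ℝ) where
  carrier := {x | ∑ i, x i = 0}
  add_mem' := by
    intro x y hx hy
    simp only [Set.mem_ofPred_eq] at hx hy
    simp [Finset.sum_add_distrib, hx, hy]
  zero_mem' := by simp
  smul_mem' := by
    intro c x hx
    simp only [Set.mem_ofPred_eq] at hx
    simp [← Finset.mul_sum, hx]

/-- `W_d`: the quotient of `ℝ^(d+1)` by the line spanned by the all-one vector. -/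
abbrev W (d : ℕ) : Type :=
  (Fin (d + 1) → ℝ) ⧸ Submodule.span ℝ {(1 : Fin (d + 1) → ℝ)}

/-- `U_d^α`: the translate of `V_d` that contains `α`. -/
def U {d : ℕ} (α : Fin (d + 1) → ℝ) : Set (Fin (d + 1) → ℝ) := {x | ∑ i, x i = ∑ i, α i}

/-- The perfect pairing of `W_d` and `V_d` induced by the dot product of `ℝ^(d+1)`. -/
def pairing (d : ℕ) : W d →ₗ[ℝ] V d →ₗ[ℝ] ℝ :=
  Submodule.liftQ _
    (LinearMap.mk₂ ℝ (fun (w : Fin (d + 1) → ℝ) (x : V d) => ∑ i, w i * x.1 i)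
      (by intro w w' x; simp [add_mul, Finset.sum_add_distrib])
      (by intro c w x; simp [Finset.mul_sum, mul_assoc])
      (by intro w x x'; simp [mul_add, Finset.sum_add_distrib])
      (by intro c w x; simp [Finset.mul_sum, mul_left_comm]))
    (by
      rw [Submodule.span_le]
      intro w hw
      rw [Set.mem_singleton_iff] at hw
      subst hw
      rw [SetLike.mem_coe, LinearMap.mem_ker]
      ext x
      have hx : ∑ i, x.1 i = 0 := x.2
      simpa using hx)

/-- The functional `w ↦ w_j - w_i` on `W_d`. -/
def coordDiff {d : ℕ} (i j : Fin (d + 1)) : W d →ₗ[ℝ] ℝ :=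
  Submodule.liftQ _
    ({ toFun := fun w => w j - w i
       map_add' := by intro w w'; simp only [Pi.add_apply]; ring
       map_smul' := by
         intro c w
         simp only [Pi.smul_apply, smul_eq_mul, RingHom.id_apply]
         ring } : (Fin (d + 1) → ℝ) →ₗ[ℝ] ℝ)
    (by
      rw [Submodule.span_le]
      intro w hw
      rw [Set.mem_singleton_iff] at hw
      subst hw
      rw [SetLike.mem_coe, LinearMap.mem_ker]
      exact sub_self (1 : ℝ))

/-- The normal cone of `P` at `F`, where `F ⊆ P` and `P` lies in a translate of `V_d` (so that all
differences `y - y'` below are in `V_d`): the `w` with `⟨w, y⟩ ≥ ⟨w, y'⟩` for all `y ∈ F`,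
`y' ∈ P`. -/
def ncone {d : ℕ} (F P : Set (Fin (d + 1) → ℝ)) : Set (W d) :=
  {w | ∀ y ∈ F, ∀ y' ∈ P, ∀ h : y - y' ∈ V d, 0 ≤ pairing d w ⟨y - y', h⟩}

/-- The normal fan of `P`: the normal cones at all nonempty faces of `P`. -/
def normalFan {d : ℕ} (P : Set (Fin (d + 1) → ℝ)) : Set (Set (W d)) :=
  {C | ∃ F, IsNonemptyFace P F ∧ C = ncone F P}

/-- A collection of cones in `W_d` is projective if it is the normal fan of a (nonempty) polytope
lying in a translate of `V_d`. -/
def IsProjective {d : ℕ} (Fan : Set (Set (W d))) : Prop :=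
  ∃ (a : Fin (d + 1) → ℝ) (s : Finset (Fin (d + 1) → ℝ)),
    s.Nonempty ∧ (s : Set (Fin (d + 1) → ℝ)) ⊆ U a ∧
      normalFan (convexHull ℝ (s : Set (Fin (d + 1) → ℝ))) = Fan

/-! ### Strictly branching plane rooted trees -/

/-- Unlabeled plane rooted trees that are strictly branching: a tree is a single vertex (a leaf), or
a root with a linearly ordered family of at least two subtrees. -/
inductive PlaneTree : Type
  | leaf : PlaneTree
  | node (k : ℕ) (child : Fin (k + 2) → PlaneTree) : PlaneTree

namespace PlaneTree

/-- The number of leaves. -/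
def numLeaves : PlaneTree → ℕ
  | leaf => 1
  | node _ c => ∑ j, (c j).numLeaves

/-- The number of internal vertices. -/
def numInternal : PlaneTree → ℕ
  | leaf => 0
  | node _ c => 1 + ∑ j, (c j).numInternal

/-- The leaves of a tree in left-to-right order. A vertex is encoded by the path that leads from the
root to it, the list of the positions of the children that one descends to. -/
def leafPaths : PlaneTree → List (List ℕ)
  | leaf => [[]]
  | node k c => (List.finRange (k + 2)).flatMap fun j => (c j).leafPaths.map (j.val :: ·)

/-- The longest common prefix of two paths: the closest common ancestor of two vertices. -/
def commonAncestor : List ℕ → List ℕ → List ℕ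
  | a :: p, b :: q => if a = b then a :: commonAncestor p q else []
  | _, _ => []

/-- The internal vertex carrying the label `i + 1`, namely the closest common ancestor of the
consecutive leaves `ℓ_{i+1}` and `ℓ_{i+2}` (leaves are counted from `1`, lists from `0`). It is
meaningful for `i + 1 < numLeaves T`. -/
def labelVertex (T : PlaneTree) (i : ℕ) : List ℕ :=
  commonAncestor (T.leafPaths.getD i []) (T.leafPaths.getD (i + 1) [])

/-- The subtree rooted at the vertex with the given path. -/
def subtreeAt : PlaneTree → List ℕ → PlaneTree
  | T, [] => T
  | leaf, _ :: _ => leaf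
  | node k c, a :: p => if h : a < k + 2 then (c ⟨a, h⟩).subtreeAt p else leaf

/-- The preorder `≼_T` on labels, whose Hasse diagram is the tree of internal vertices with the root
on top: `i ≼_T j` if the vertex labeled by `j` is an ancestor of, or equal to, the vertex labeled
by `i`. Labels are shifted by one as in `labelVertex`. -/
def labelLE (T : PlaneTree) (i j : ℕ) : Prop := T.labelVertex j <+: T.labelVertex i

end PlaneTree

/-- `𝒯_n`: the strictly branching plane rooted trees with `n + 1` leaves. -/
def trees (n : ℕ) : Set PlaneTree := {T | T.numLeaves = n + 1}

/-- `𝒯_{n,k}`: the trees in `𝒯_n` with `k` internal vertices. In particular `𝒯_{n,n}` consists of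
the complete binary trees with `n + 1` leaves. -/
def treesInternal (n k : ℕ) : Set PlaneTree := {T | T ∈ trees n ∧ T.numInternal = k}

/-- The sum of the first `t` entries of `β`. -/
def prefixSum {n : ℕ} (β : Fin n → ℝ) (t : ℕ) : ℝ :=
  ∑ k ∈ Finset.univ.filter (fun k : Fin n => k.val < t), β k

/-- `val(β, T)`: the sum of the first `t` entries of `β`, where `t` is the number of internal
vertices of `T`, minus the same quantity for each of the subtrees below the root (for a binary tree,
the Left and the Right subtree). -/
def treeVal {n : ℕ} (β : Fin n → ℝ) : PlaneTree → ℝ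
  | .leaf => 0
  | .node k c =>
      prefixSum β (PlaneTree.node k c).numInternal - ∑ j, prefixSum β (c j).numInternal

/-! ### Ordered partitions and partition labeled trees -/

/-- Ordered set partitions of `{0, …, n - 1}` with `k` (nonempty) blocks. -/
structure OrderedPartition (n k : ℕ) where
  block : Fin k → Finset (Fin n)
  nonempty : ∀ a, (block a).Nonempty
  disjoint : ∀ a b, a ≠ b → Disjoint (block a) (block b)
  cover : ∀ i, ∃ a, i ∈ block a

/-- `R` refines `S` as ordered partitions: each block of `R` lies in a block of `S`, compatibly with
the orders of the blocks. -/
def OrderedPartition.Refines {n k l : ℕ} (R : OrderedPartition n k) (S : OrderedPartition n l) :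
    Prop :=
  ∃ f : Fin k → Fin l, Monotone f ∧ ∀ a, R.block a ⊆ S.block (f a)

/-- `𝒮(π) = ({π⁻¹(1)}, {π⁻¹(2)}, …)`. -/
def permPartition {n : ℕ} (π : Equiv.Perm (Fin n)) : OrderedPartition n n where
  block a := {π.symm a}
  nonempty a := Finset.singleton_nonempty _
  disjoint a b h := by simpa using h
  cover i := ⟨π i, by simp⟩

/-- The entry `t_{a+1} = |S_1| + ⋯ + |S_{a+1}|` of the type of `S = (S_1, …, S_{m+1})`. -/
def OrderedPartition.typeEntry {n m : ℕ} (S : OrderedPartition n (m + 1)) (a : Fin m) : ℕ :=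
  ∑ b ∈ Finset.univ.filter (fun b : Fin (m + 1) => b.val ≤ a.val), (S.block b).card

/-- `𝒫_d`: pairs of an ordered partition of `[d+1]` and a strictly branching tree with as many
leaves as the partition has blocks. (There are at most `d + 1` blocks, as blocks are nonempty.) -/
structure PartitionLabeledTree (d : ℕ) where
  m : ℕ
  partition : OrderedPartition (d + 1) (m + 1)
  tree : PlaneTree
  tree_mem : tree ∈ trees m

/-- The preorder `≼_(𝒮,T)` on the set `Type(𝒮)`, obtained from `≼_T` by replacing the label `a` with
`t_a`. Elements of `{1, …, d}` are represented by `Fin d`, shifted by one. -/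
def PartitionLabeledTree.typeLE {d : ℕ} (X : PartitionLabeledTree d) (i j : Fin d) : Prop :=
  ∃ a b : Fin X.m, X.partition.typeEntry a = i.val + 1 ∧ X.partition.typeEntry b = j.val + 1 ∧
    X.tree.labelLE a.val b.val

/-- `i` is an element of `Type(𝒮)` that is minimal for `≼_(𝒮,T)`. -/
def PartitionLabeledTree.IsMinimalType {d : ℕ} (X : PartitionLabeledTree d) (i : Fin d) : Prop :=
  (∃ a : Fin X.m, X.partition.typeEntry a = i.val + 1) ∧ ∀ j, X.typeLE j i → X.typeLE i j

/-- `D^π_i w = w_{π⁻¹(i+1)} - w_{π⁻¹(i)}`. -/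
def D {d : ℕ} (π : Equiv.Perm (Fin (d + 1))) (i : Fin d) : W d →ₗ[ℝ] ℝ :=
  coordDiff (π.symm i.castSucc) (π.symm i.succ)

/-- The cone `σ(𝒮,T)`: those `w` that are constant on the blocks of `𝒮` and satisfy, for a `π` such
that `𝒮(π)` refines `𝒮`, the inequalities `D^π_i w ≤ D^π_j w` for `i ≼_(𝒮,T) j`, and `D^π_i w ≥ 0`
for `i` minimal. The choice of `π` does not matter. -/
def PartitionLabeledTree.cone {d : ℕ} (X : PartitionLabeledTree d) : Set (W d) :=
  {w | (∀ a, ∀ i ∈ X.partition.block a, ∀ j ∈ X.partition.block a, coordDiff i j w = 0) ∧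
    ∃ π : Equiv.Perm (Fin (d + 1)), (permPartition π).Refines X.partition ∧
      (∀ i j, X.typeLE i j → D π i w ≤ D π j w) ∧
      (∀ i, X.IsMinimalType i → 0 ≤ D π i w)}

/-- The nested Loday fan `Ξ_d = {σ(𝒮,T) : (𝒮,T) ∈ 𝒫_d}`. -/
def nestedLodayFan (d : ℕ) : Set (Set (W d)) := Set.range (PartitionLabeledTree.cone (d := d))

/-- `σ(π,T) = σ(𝒮(π),T)`. -/
def permCone {d : ℕ} (π : Equiv.Perm (Fin (d + 1))) (T : PlaneTree) (hT : T ∈ trees d) :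
    Set (W d) :=
  PartitionLabeledTree.cone ⟨d, permPartition π, T, hT⟩

/-! ### The nested permuto-associahedron -/

/-- `f^π_i = e_{π⁻¹(i+1)} - e_{π⁻¹(i)}`. -/
def fvec {d : ℕ} (π : Equiv.Perm (Fin (d + 1))) (i : Fin d) : Fin (d + 1) → ℝ :=
  Pi.single (π.symm i.succ) 1 - Pi.single (π.symm i.castSucc) 1

/-- `β_{T,i} = val(β, T_(i))`, where `T_(i)` is the subtree of `T` rooted at the internal vertex
labeled by `i` (labels shifted by one). -/
def treeCoeff {d : ℕ} (β : Fin d → ℝ) (T : PlaneTree) (i : Fin d) : ℝ :=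
  treeVal β (T.subtreeAt (T.labelVertex i.val))

/-- `v_{π,T} = ∑ α_i e_{π⁻¹(i)} + ∑ β_{T,i} f^π_i`. -/
def vpt {d : ℕ} (α : Fin (d + 1) → ℝ) (β : Fin d → ℝ) (π : Equiv.Perm (Fin (d + 1)))
    (T : PlaneTree) : Fin (d + 1) → ℝ :=
  ∑ i, α i • Pi.single (π.symm i) 1 + ∑ i, treeCoeff β T i • fvec π i

/-- `(α, β)` is a `𝒯`-appropriate pair of strictly increasing sequences: for every complete binary
tree `T` with `d + 1` leaves, the coefficient of `e_{π⁻¹(i)}` in `v_{π,T}` is strictly increasing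
in `i` (this coefficient does not depend on `π`). -/
structure IsTreeAppropriate {d : ℕ} (α : Fin (d + 1) → ℝ) (β : Fin d → ℝ) : Prop where
  strictMono_fst : StrictMono α
  strictMono_snd : StrictMono β
  strictMono_coeff : ∀ T ∈ treesInternal d d, ∀ π : Equiv.Perm (Fin (d + 1)),
    StrictMono fun i => vpt α β π T (π.symm i)

/-- The set of all points `v_{π,T}`, with `π` a permutation of `[d+1]` and `T` a complete binary
tree with `d + 1` leaves. -/
def permAssoPoints {d : ℕ} (α : Fin (d + 1) → ℝ) (β : Fin d → ℝ) : Set (Fin (d + 1) → ℝ) :=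
  {x | ∃ π : Equiv.Perm (Fin (d + 1)), ∃ T ∈ treesInternal d d, x = vpt α β π T}

/-- The nested permuto-associahedron. -/
def permAsso {d : ℕ} (α : Fin (d + 1) → ℝ) (β : Fin d → ℝ) : Set (Fin (d + 1) → ℝ) :=
  convexHull ℝ (permAssoPoints α β)

end NestedPermAsso

end

open NestedPermAsso

namespace NestedPermAsso

/-! ### Paths and consecutive leaves -/

namespace PlaneTree

@[simp] theorem commonAncestor_nil_left (p : List ℕ) : commonAncestor [] p = [] := by
  simp [commonAncestor]

@[simp] theorem commonAncestor_nil_right (p : List ℕ) : commonAncestor p [] = [] := by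
  cases p <;> simp [commonAncestor]

theorem commonAncestor_cons (a b : ℕ) (p q : List ℕ) :
    commonAncestor (a :: p) (b :: q) = if a = b then a :: commonAncestor p q else [] := by
  simp [commonAncestor]

theorem commonAncestor_prefix_left (p q : List ℕ) : commonAncestor p q <+: p := by
  induction p generalizing q with
  | nil => simp
  | cons a p ih =>
    cases q with
    | nil => simp
    | cons b q =>
      rw [commonAncestor_cons]
      split_ifs
      · simpa using ih q
      · simp

theorem commonAncestor_comm (p q : List ℕ) : commonAncestor p q = commonAncestor q p := by
  induction p generalizing q with
  | nil => simp
  | cons a p ih =>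
    cases q with
    | nil => simp
    | cons b q =>
      simp only [commonAncestor_cons, ih q, eq_comm (a := a)]
      split_ifs with h
      · rw [h]
      · rfl

theorem commonAncestor_prefix_right (p q : List ℕ) : commonAncestor p q <+: q := by
  rw [commonAncestor_comm]
  exact commonAncestor_prefix_left q p

theorem prefix_commonAncestor {s p q : List ℕ} (hp : s <+: p) (hq : s <+: q) :
    s <+: commonAncestor p q := by
  induction s generalizing p q with
  | nil => simp
  | cons a s ih =>
    obtain ⟨p, rfl⟩ := hp
    obtain ⟨q, rfl⟩ := hq
    simp only [List.cons_append, commonAncestor_cons, if_true, List.cons_prefix_cons, true_and]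
    exact ih (by simp) (by simp)

/-- The left-to-right order of vertices given by their paths. -/
def PathLE : List ℕ → List ℕ → Prop
  | [], _ => True
  | _ :: _, [] => False
  | a :: p, b :: q => a < b ∨ a = b ∧ PathLE p q

theorem commonAncestor_of_pathLE {p q r : List ℕ} (hpq : PathLE p q) (hqr : PathLE q r) :
    (commonAncestor p r = commonAncestor p q ∧ commonAncestor p q <+: commonAncestor q r) ∨
      (commonAncestor p r = commonAncestor q r ∧ commonAncestor q r <+: commonAncestor p q) := by
  induction p generalizing q r with
  | nil => simp
  | cons a p ih =>
    cases q with
    | nil => simp [PathLE] at hpq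
    | cons b q =>
      cases r with
      | nil => simp [PathLE] at hqr
      | cons c r =>
        simp only [PathLE] at hpq hqr
        simp only [commonAncestor_cons]
        rcases hpq with h1 | ⟨rfl, h1⟩ <;> rcases hqr with h2 | ⟨rfl, h2⟩
        · simp [h1.ne, h2.ne, (h1.trans h2).ne]
        · simp [h1.ne]
        · simp [h2.ne]
        · simpa using ih h1 h2

theorem length_leafPaths (T : PlaneTree) : T.leafPaths.length = T.numLeaves := by
  induction T with
  | leaf => simp [leafPaths, numLeaves]
  | node k c ih =>
    simp [leafPaths, numLeaves, List.length_flatMap, ih, Fin.sum_univ_def]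

theorem pairwise_leafPaths (T : PlaneTree) : T.leafPaths.Pairwise PathLE := by
  induction T with
  | leaf => simp [leafPaths]
  | node k c ih =>
    rw [leafPaths, List.pairwise_flatMap]
    refine ⟨fun j _ => ?_, ?_⟩
    · rw [List.pairwise_map]
      exact (ih j).imp fun h => Or.inr ⟨rfl, h⟩
    · refine (List.pairwise_lt_finRange (k + 2)).imp fun {i j} hij p hp q hq => ?_
      simp only [List.mem_map] at hp hq
      obtain ⟨p, -, rfl⟩ := hp
      obtain ⟨q, -, rfl⟩ := hq
      exact Or.inl hij

/-- The closest common ancestor of the consecutive entries `i`, `i + 1` of a list of paths. -/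
def gapPath (L : List (List ℕ)) (i : ℕ) : List ℕ :=
  commonAncestor (L.getD i []) (L.getD (i + 1) [])

theorem labelVertex_eq_gapPath (T : PlaneTree) (i : ℕ) :
    T.labelVertex i = gapPath T.leafPaths i := rfl

theorem pathLE_getD {L : List (List ℕ)} (hL : L.Pairwise PathLE) {i j : ℕ} (hij : i < j)
    (hj : j < L.length) : PathLE (L.getD i []) (L.getD j []) := by
  rw [List.getD_eq_getElem _ _ hj, List.getD_eq_getElem _ _ (hij.trans hj)]
  exact List.pairwise_iff_getElem.1 hL i j _ _ hij

theorem exists_gapPath_eq {L : List (List ℕ)} (hL : L.Pairwise PathLE) {i j : ℕ} (hij : i ≤ j)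
    (hj : j + 1 < L.length) :
    (∃ m, i ≤ m ∧ m ≤ j ∧ commonAncestor (L.getD i []) (L.getD (j + 1) []) = gapPath L m) ∧
      ∀ k, i ≤ k → k ≤ j → commonAncestor (L.getD i []) (L.getD (j + 1) []) <+: gapPath L k := by
  induction j, hij using Nat.le_induction with
  | base =>
    refine ⟨⟨i, le_rfl, le_rfl, rfl⟩, fun k h1 h2 => ?_⟩
    obtain rfl := le_antisymm h1 h2
    exact List.prefix_refl _
  | succ j hij ih =>
    obtain ⟨⟨m, h1, h2, hm⟩, ih2⟩ := ih (by omega)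
    have key := commonAncestor_of_pathLE (pathLE_getD hL (show i < j + 1 by omega) (by omega))
      (pathLE_getD hL (show j + 1 < j + 1 + 1 by omega) hj)
    rcases key with ⟨e, h⟩ | ⟨e, h⟩
    · refine ⟨⟨m, h1, by omega, e.trans hm⟩, fun k hk hk' => ?_⟩
      rw [e]
      rcases Nat.lt_or_ge j k with hjk | hjk
      · obtain rfl : k = j + 1 := by omega
        exact h
      · exact ih2 k hk hjk
    · refine ⟨⟨j + 1, by omega, le_rfl, e⟩, fun k hk hk' => ?_⟩
      rw [e]
      rcases Nat.lt_or_ge j k with hjk | hjk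
      · obtain rfl : k = j + 1 := by omega
        exact List.prefix_refl _
      · exact h.trans (ih2 k hk hjk)

/-! ### The preorder on labels -/

theorem labelLE_refl (T : PlaneTree) (i : ℕ) : T.labelLE i i := List.prefix_refl _

theorem labelLE_trans {T : PlaneTree} {i j k : ℕ} (hij : T.labelLE i j) (hjk : T.labelLE j k) :
    T.labelLE i k := List.IsPrefix.trans hjk hij

theorem exists_labelLE_of_le {n : ℕ} {T : PlaneTree} (hT : T ∈ trees n) {i j : ℕ} (hij : i ≤ j)
    (hj : j < n) : ∃ m, i ≤ m ∧ m ≤ j ∧ ∀ k, i ≤ k → k ≤ j → T.labelLE k m := by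
  have hl : T.leafPaths.length = n + 1 := (length_leafPaths T).trans hT
  obtain ⟨⟨m, h1, h2, hm⟩, h⟩ := exists_gapPath_eq (pairwise_leafPaths T) hij (by omega)
  refine ⟨m, h1, h2, fun k hk hk' => ?_⟩
  have := h k hk hk'
  rwa [hm] at this

theorem labelLE_of_between {n : ℕ} {T : PlaneTree} (hT : T ∈ trees n) {i j k : ℕ} (hi : i < n)
    (hj : j < n) (hij : T.labelLE i j) (hk : min i j ≤ k) (hk' : k ≤ max i j) :
    T.labelLE k j := by
  have hl : T.leafPaths.length = n + 1 := (length_leafPaths T).trans hT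
  have l1 : ∀ i, T.labelVertex i <+: T.leafPaths.getD i [] := fun i =>
    commonAncestor_prefix_left _ _
  have l2 : ∀ i, T.labelVertex i <+: T.leafPaths.getD (i + 1) [] := fun i =>
    commonAncestor_prefix_right _ _
  rcases le_total i j with h | h
  · obtain ⟨-, H⟩ := exists_gapPath_eq (pairwise_leafPaths T) h (by omega)
    exact (prefix_commonAncestor (hij.trans (l1 i)) (l2 j)).trans (H k (by omega) (by omega))
  · obtain ⟨-, H⟩ := exists_gapPath_eq (pairwise_leafPaths T) h (by omega)
    exact (prefix_commonAncestor (l1 j) (hij.trans (l2 i))).trans (H k (by omega) (by omega))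

theorem labelVertex_eq_of_length_eq {T : PlaneTree} {i j : ℕ} (h : T.labelLE i j)
    (hl : (T.labelVertex i).length ≤ (T.labelVertex j).length) : T.labelLE j i := by
  have := h.eq_of_length_le hl
  rw [labelLE, this]

/-! ### Grafting -/

theorem gapPath_append_left {A B : List (List ℕ)} {i : ℕ} (hi : i + 1 < A.length) :
    gapPath (A ++ B) i = gapPath A i := by
  rw [gapPath, List.getD_append _ _ _ _ hi, List.getD_append _ _ _ _ (by omega), gapPath]

theorem gapPath_append_right {A B : List (List ℕ)} (i : ℕ) :
    gapPath (A ++ B) (A.length + i) = gapPath B i := by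
  rw [gapPath, List.getD_append_right _ _ _ _ (by omega),
    List.getD_append_right _ _ _ _ (by omega), gapPath]
  congr 2 <;> omega

theorem gapPath_map {φ : List ℕ → List ℕ} (hφ : ∀ p q, commonAncestor (φ p) (φ q) =
    φ (commonAncestor p q)) {A : List (List ℕ)} {i : ℕ} (hi : i + 1 < A.length) :
    gapPath (A.map φ) i = φ (gapPath A i) := by
  have h1 : i < A.length := by omega
  rw [gapPath, List.getD_eq_getElem _ _ (by simpa using h1),
    List.getD_eq_getElem _ _ (by simpa using hi), gapPath, List.getD_eq_getElem _ _ h1,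
    List.getD_eq_getElem _ _ hi, List.getElem_map, List.getElem_map, hφ]

theorem gapPath_append_mid {A B : List (List ℕ)} {i : ℕ} (hi : i + 1 = A.length) (hB : B ≠ [])
    (h : ∀ p ∈ A, ∀ q ∈ B, commonAncestor p q = []) : gapPath (A ++ B) i = [] := by
  have h0 : 0 < B.length := List.length_pos_iff.2 hB
  rw [gapPath, List.getD_append _ _ _ _ (by omega), List.getD_append_right _ _ _ _ (by omega),
    List.getD_eq_getElem _ _ (by omega), List.getD_eq_getElem _ _ (by omega)]
  exact h _ (List.getElem_mem _) _ (List.getElem_mem _)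

/-- Increase the first entry of a path. -/
def bump : List ℕ → List ℕ
  | [] => []
  | a :: p => (a + 1) :: p

theorem commonAncestor_bump (p q : List ℕ) :
    commonAncestor (bump p) (bump q) = bump (commonAncestor p q) := by
  cases p with
  | nil => simp [bump]
  | cons a p =>
    cases q with
    | nil => simp [bump]
    | cons b q =>
      simp only [commonAncestor_cons, bump, Nat.add_right_cancel_iff]
      split_ifs <;> rfl

theorem bump_prefix_bump {p q : List ℕ} : bump p <+: bump q ↔ p <+: q := by
  cases p <;> cases q <;> simp [bump]

theorem leafPaths_node_zero (c : Fin 2 → PlaneTree) :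
    (node 0 c).leafPaths = (c 0).leafPaths.map (0 :: ·) ++ (c 1).leafPaths.map (1 :: ·) := by
  simp [leafPaths, List.finRange_succ]

theorem leafPaths_node_cons (k : ℕ) (L : PlaneTree) (c : Fin (k + 2) → PlaneTree) :
    (node (k + 1) (Fin.cons L c : Fin (k + 3) → PlaneTree)).leafPaths =
      L.leafPaths.map (0 :: ·) ++ (node k c).leafPaths.map bump := by
  simp only [leafPaths]
  rw [List.finRange_succ, List.flatMap_cons, List.flatMap_map, List.map_flatMap]
  congr 1
  refine List.flatMap_congr fun j _ => ?_
  simp [bump, Function.comp_def]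

theorem numLeaves_node_cons (k : ℕ) (L : PlaneTree) (c : Fin (k + 2) → PlaneTree) :
    (node (k + 1) (Fin.cons L c : Fin (k + 3) → PlaneTree)).numLeaves =
      L.numLeaves + (node k c).numLeaves := by
  simp only [numLeaves]
  rw [Fin.sum_univ_succ]
  simp

theorem numLeaves_node_zero (c : Fin 2 → PlaneTree) :
    (node 0 c).numLeaves = (c 0).numLeaves + (c 1).numLeaves := by
  simp only [numLeaves]
  exact Fin.sum_univ_two _

theorem numInternal_node_zero (c : Fin 2 → PlaneTree) :
    (node 0 c).numInternal = 1 + ((c 0).numInternal + (c 1).numInternal) := by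
  simp only [numInternal]
  exact congrArg (1 + ·) (Fin.sum_univ_two _)

theorem numInternal_lt_numLeaves (T : PlaneTree) : T.numInternal + 1 ≤ T.numLeaves := by
  induction T with
  | leaf => simp [numInternal, numLeaves]
  | node k c ih =>
    have : ∑ j, ((c j).numInternal + 1) ≤ ∑ j, (c j).numLeaves :=
      Finset.sum_le_sum fun j _ => ih j
    simp [Finset.sum_add_distrib] at this
    simp only [numInternal, numLeaves]
    omega

theorem numLeaves_pos (T : PlaneTree) : 0 < T.numLeaves :=
  lt_of_lt_of_le (Nat.succ_pos _) T.numInternal_lt_numLeaves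

theorem leafPaths_ne_nil (T : PlaneTree) : T.leafPaths ≠ [] := by
  rw [← List.length_pos_iff, length_leafPaths]
  exact T.numLeaves_pos

theorem labelVertex_glue {T A B : PlaneTree} {φ : List ℕ → List ℕ}
    (hT : T.leafPaths = A.leafPaths.map (0 :: ·) ++ B.leafPaths.map φ)
    (hφ : ∀ p q, commonAncestor (φ p) (φ q) = φ (commonAncestor p q))
    (hφ0 : ∀ q ∈ B.leafPaths, ∀ p, commonAncestor (0 :: p) (φ q) = []) {a b : ℕ}
    (hA : A ∈ trees a) (hB : B ∈ trees b) :
    (∀ i < a, T.labelVertex i = 0 :: A.labelVertex i) ∧ T.labelVertex a = [] ∧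
      ∀ i < b, T.labelVertex (a + 1 + i) = φ (B.labelVertex i) := by
  have hlA : A.leafPaths.length = a + 1 := (length_leafPaths A).trans hA
  have hlB : B.leafPaths.length = b + 1 := (length_leafPaths B).trans hB
  simp only [labelVertex_eq_gapPath, hT]
  refine ⟨fun i hi => ?_, ?_, fun i hi => ?_⟩
  · rw [gapPath_append_left (by simp; omega), gapPath_map _ (by omega)]
    intro p q
    simp [commonAncestor_cons]
  · refine gapPath_append_mid (by simp [hlA]) (by simp [leafPaths_ne_nil]) ?_
    intro p hp q hq
    simp only [List.mem_map] at hp hq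
    obtain ⟨p, -, rfl⟩ := hp
    obtain ⟨q, hq, rfl⟩ := hq
    exact hφ0 q hq p
  · have := gapPath_append_right (A := A.leafPaths.map (0 :: ·)) (B := B.leafPaths.map φ) i
    rw [List.length_map, hlA] at this
    rw [this, gapPath_map hφ (by omega)]

theorem labelVertex_node_zero {c : Fin 2 → PlaneTree} {a b : ℕ}
    (hA : c 0 ∈ trees a) (hB : c 1 ∈ trees b) :
    (∀ i < a, (node 0 c).labelVertex i = 0 :: (c 0).labelVertex i) ∧
      (node 0 c).labelVertex a = [] ∧
      ∀ i < b, (node 0 c).labelVertex (a + 1 + i) = 1 :: (c 1).labelVertex i :=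
  labelVertex_glue (leafPaths_node_zero c) (fun p q => by simp [commonAncestor_cons])
    (fun q _ p => by simp [commonAncestor_cons]) hA hB

theorem labelVertex_node_cons {k : ℕ} {L : PlaneTree} {c : Fin (k + 2) → PlaneTree} {a b : ℕ}
    (hA : L ∈ trees a) (hB : node k c ∈ trees b) :
    (∀ i < a, (node (k + 1) (Fin.cons L c : Fin (k + 3) → PlaneTree)).labelVertex i =
      0 :: L.labelVertex i) ∧
      (node (k + 1) (Fin.cons L c : Fin (k + 3) → PlaneTree)).labelVertex a = [] ∧
      ∀ i < b, (node (k + 1) (Fin.cons L c : Fin (k + 3) → PlaneTree)).labelVertex (a + 1 + i) =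
        bump ((node k c).labelVertex i) :=
  labelVertex_glue (leafPaths_node_cons k L c) commonAncestor_bump
    (fun q _ p => by cases q <;> simp [commonAncestor_cons, bump]) hA hB

/-! ### Trees from functions -/

theorem exists_first_argmax {γ : Type*} [LinearOrder γ] (n : ℕ) (g : ℕ → γ) :
    ∃ p ≤ n, (∀ i ≤ n, g i ≤ g p) ∧ ∀ i < p, g i < g p := by
  classical
  have hex : ∃ p, p ≤ n ∧ ∀ i ≤ n, g i ≤ g p := by
    obtain ⟨p, hp, h⟩ := Finset.exists_max_image (Finset.range (n + 1)) g ⟨0, by simp⟩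
    exact ⟨p, by simpa [Nat.lt_succ_iff] using hp, fun i hi => h i (by simp; omega)⟩
  refine ⟨Nat.find hex, (Nat.find_spec hex).1, (Nat.find_spec hex).2, fun i hi => ?_⟩
  refine lt_of_le_of_ne ((Nat.find_spec hex).2 i (hi.le.trans (Nat.find_spec hex).1)) fun h => ?_
  exact Nat.find_min hex hi ⟨hi.le.trans (Nat.find_spec hex).1,
    fun j hj => ((Nat.find_spec hex).2 j hj).trans h.ge⟩

/-- `g` increases weakly towards the root of `T`, and strictly between different vertices. -/
def StrictlyAdapted {γ : Type*} [LinearOrder γ] (T : PlaneTree) (n : ℕ) (g : ℕ → γ) : Prop :=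
  ∀ i < n, ∀ j < n, T.labelLE i j → g i ≤ g j ∧ (g j ≤ g i → T.labelLE j i)

theorem lt_split {a b i : ℕ} (h : i < a + 1 + b) :
    i < a ∨ i = a ∨ ∃ j < b, i = a + 1 + j := by
  rcases lt_trichotomy i a with h1 | h1 | h1
  · exact Or.inl h1
  · exact Or.inr (Or.inl h1)
  · exact Or.inr (Or.inr ⟨i - (a + 1), by omega, by omega⟩)

theorem strictlyAdapted_glue {γ : Type*} [LinearOrder γ] {T A B : PlaneTree} {a b : ℕ} {g : ℕ → γ}
    {φ : List ℕ → List ℕ}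
    (hT : (∀ i < a, T.labelVertex i = 0 :: A.labelVertex i) ∧ T.labelVertex a = [] ∧
      ∀ i < b, T.labelVertex (a + 1 + i) = φ (B.labelVertex i))
    (hφ : ∀ p q, φ p <+: φ q ↔ p <+: q) (hφ0 : ∀ p q, ¬ (0 :: p <+: φ q))
    (hroot : ∀ i < b, φ (B.labelVertex i) = [] ↔ g a ≤ g (a + 1 + i))
    (hmax : ∀ i < a + 1 + b, g i ≤ g a) (hmax' : ∀ i < a, g i < g a)
    (hA : A.StrictlyAdapted a g) (hB : B.StrictlyAdapted b fun i => g (a + 1 + i)) :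
    T.StrictlyAdapted (a + 1 + b) g := by
  obtain ⟨h1, h2, h3⟩ := hT
  intro i hi j hj hij
  rcases lt_split hi with hi' | rfl | ⟨i, hi', rfl⟩ <;>
    rcases lt_split hj with hj' | rfl | ⟨j, hj', rfl⟩
  · rw [labelLE, h1 i hi', h1 j hj', List.cons_prefix_cons] at hij
    rw [labelLE, h1 i hi', h1 j hj', List.cons_prefix_cons]
    exact ⟨(hA i hi' j hj' hij.2).1, fun h => ⟨rfl, (hA i hi' j hj' hij.2).2 h⟩⟩
  · exact ⟨(hmax' i hi').le, fun h => absurd h (hmax' i hi').not_ge⟩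
  · rw [labelLE, h1 i hi', h3 j hj'] at hij
    have h0 : φ (B.labelVertex j) = [] := by
      cases h : φ (B.labelVertex j) with
      | nil => rfl
      | cons x s =>
        rw [h, List.cons_prefix_cons] at hij
        obtain ⟨rfl, -⟩ := hij
        exact (hφ0 s (B.labelVertex j) (by rw [h])).elim
    have h0 := (hroot j hj').1 h0
    have h4 := hmax' i hi'
    exact ⟨(h4.trans_le h0).le, fun h => absurd h (h4.trans_le h0).not_ge⟩
  · rw [labelLE, h1 j hj', h2] at hij
    simp at hij
  · exact ⟨le_rfl, fun _ => labelLE_refl T _⟩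
  · rw [labelLE, h3 j hj', h2, List.prefix_nil] at hij
    refine ⟨(hroot j hj').1 hij, fun _ => ?_⟩
    rw [labelLE, h2]
    exact List.nil_prefix
  · rw [labelLE, h1 j hj', h3 i hi'] at hij
    exact (hφ0 _ _ hij).elim
  · refine ⟨hmax _ hi, fun h => ?_⟩
    rw [labelLE, h3 i hi', (hroot i hi').2 h]
    exact List.nil_prefix
  · rw [labelLE, h3 i hi', h3 j hj', hφ] at hij
    rw [labelLE, h3 i hi', h3 j hj', hφ]
    exact hB i hi' j hj' hij

theorem exists_strictlyAdapted {γ : Type*} [LinearOrder γ] (n : ℕ) (g : ℕ → γ) :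
    ∃ T ∈ trees n, T.StrictlyAdapted n g ∧
      (Set.InjOn g (Set.Iio n) → T.numInternal = n) := by
  induction n using Nat.strong_induction_on generalizing g with
  | _ n ih =>
  rcases n with _ | n
  · exact ⟨leaf, by simp [trees, numLeaves], fun i hi => absurd hi (Nat.not_lt_zero i),
      fun _ => by simp [numInternal]⟩
  obtain ⟨a, ha, hmax, hmax'⟩ := exists_first_argmax n g
  obtain ⟨b, rfl⟩ := Nat.exists_eq_add_of_le ha
  have hn : a + b + 1 = a + 1 + b := by omega
  obtain ⟨A, hA, hgA, hiA⟩ := ih a (by omega) g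
  obtain ⟨B, hB, hgB, hiB⟩ := ih b (by omega) fun i => g (a + 1 + i)
  by_cases hex : ∃ i < b, g a ≤ g (a + 1 + i)
  · obtain ⟨i₁, hi₁, hgi₁⟩ := hex
    cases B with
    | leaf => simp [trees, numLeaves] at hB; omega
    | node k c =>
      refine ⟨node (k + 1) (Fin.cons A c : Fin (k + 3) → PlaneTree), ?_, ?_, fun hinj => ?_⟩
      · change A.numLeaves = a + 1 at hA
        change (node k c).numLeaves = b + 1 at hB
        change PlaneTree.numLeaves _ = _
        rw [numLeaves_node_cons, hA, hB]
        omega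
      · rw [hn]
        have hroot : ∃ r < b, (node k c).labelVertex r = [] := by
          have hB' : (c 0).numLeaves - 1 < b := by
            change (node k c).numLeaves = b + 1 at hB
            rw [numLeaves, Fin.sum_univ_succ] at hB
            have h1 := (c 0).numLeaves_pos
            have h2 : 1 ≤ ∑ i : Fin (k + 1), (c i.succ).numLeaves := by
              rw [Fin.sum_univ_succ]
              have := (c (Fin.succ 0)).numLeaves_pos
              omega
            omega
          refine ⟨(c 0).numLeaves - 1, hB', ?_⟩
          rw [labelVertex_eq_gapPath, leafPaths, List.finRange_succ, List.flatMap_cons]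
          refine gapPath_append_mid ?_ ?_ ?_
          · have := (c 0).numLeaves_pos
            rw [List.length_map, length_leafPaths]
            omega
          · simp [List.finRange_succ, leafPaths_ne_nil]
          · intro p hp q hq
            simp only [List.mem_map, List.mem_flatMap] at hp hq
            obtain ⟨p, -, rfl⟩ := hp
            obtain ⟨_, ⟨j, -, rfl⟩, q, -, rfl⟩ := hq
            simp [commonAncestor_cons]
        obtain ⟨r, hr, hVr⟩ := hroot
        have hle : ∀ i, (node k c).labelLE i r := fun i => by
          rw [labelLE, hVr]
          exact List.nil_prefix
        refine strictlyAdapted_glue (labelVertex_node_cons hA hB) (fun p q => bump_prefix_bump)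
          (fun p q => by cases q <;> simp [bump]) (fun i hi => ?_)
          (fun i hi => hmax i (by omega)) hmax' hgA hgB
        have hbump : bump ((node k c).labelVertex i) = [] ↔ (node k c).labelVertex i = [] := by
          cases (node k c).labelVertex i <;> simp [bump]
        have hgr : g a ≤ g (a + 1 + r) := hgi₁.trans (hgB i₁ hi₁ r hr (hle i₁)).1
        rw [hbump]
        constructor
        · intro h
          refine hgr.trans (hgB r hr i hi ?_).1
          rw [labelLE, h]
          exact List.nil_prefix
        · intro h
          have := (hgB i hi r hr (hle i)).2 ((hmax _ (by omega)).trans h)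
          rwa [labelLE, hVr, List.prefix_nil] at this
      · have h1 : a = a + 1 + i₁ := hinj (by simp) (by simp; omega)
          (le_antisymm hgi₁ (hmax _ (by omega)))
        omega
  · push Not at hex
    refine ⟨node 0 ![A, B], ?_, ?_, fun hinj => ?_⟩
    · change A.numLeaves = a + 1 at hA
      change B.numLeaves = b + 1 at hB
      change PlaneTree.numLeaves _ = _
      rw [numLeaves_node_zero]
      simp [hA, hB]
      omega
    · rw [hn]
      refine strictlyAdapted_glue (labelVertex_node_zero (c := ![A, B]) hA hB)
        (fun p q => by simp) (fun p q => by simp)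
        (fun i hi => ?_) (fun i hi => hmax i (by omega)) hmax' hgA hgB
      simpa using hex i hi
    · rw [numInternal_node_zero]
      have e1 := hiA (hinj.mono fun x hx => by simp at hx ⊢; omega)
      have e2 := hiB fun x hx y hy h => by
        have := hinj (show a + 1 + x ∈ _ by simp at hx ⊢; omega)
          (show a + 1 + y ∈ _ by simp at hy ⊢; omega) h
        omega
      simp [e1, e2]
      omega

/-! ### Binary trees -/

theorem binary_node {k : ℕ} {c : Fin (k + 2) → PlaneTree}
    (h : (node k c).numLeaves = (node k c).numInternal + 1) :
    k = 0 ∧ ∀ j, (c j).numLeaves = (c j).numInternal + 1 := by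
  simp only [numInternal, numLeaves] at h
  have hle : ∀ j ∈ Finset.univ, (c j).numInternal + 1 ≤ (c j).numLeaves :=
    fun j _ => (c j).numInternal_lt_numLeaves
  have hs := Finset.sum_le_sum hle
  have e : ∑ j, ((c j).numInternal + 1) = ∑ j, (c j).numInternal + (k + 2) := by
    simp [Finset.sum_add_distrib]
  have hk : k = 0 := by omega
  refine ⟨hk, fun j => ?_⟩
  exact ((Finset.sum_eq_sum_iff_of_le hle).1 (by omega) j (Finset.mem_univ j)).symm

theorem labelVertex_injOn_and_lowerSet {n : ℕ} {T : PlaneTree} (hT : T ∈ treesInternal n n) :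
    (∀ i < n, ∀ j < n, T.labelVertex i = T.labelVertex j → i = j) ∧
    ∀ i < n, ∃ lo hi, lo ≤ i ∧ i ≤ hi ∧ hi < n ∧ (∀ k < n, T.labelLE k i ↔ lo ≤ k ∧ k ≤ hi) ∧
      ∀ {N : ℕ} (β : Fin N → ℝ), treeVal β (T.subtreeAt (T.labelVertex i)) =
        prefixSum β (hi + 1 - lo) - prefixSum β (i - lo) - prefixSum β (hi - i) := by
  induction T generalizing n with
  | leaf =>
    obtain rfl : n = 0 := by simpa [numInternal] using hT.2.symm
    simp
  | node k c ih =>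
    have hl : (node k c).numLeaves = n + 1 := hT.1
    have hi : (node k c).numInternal = n := hT.2
    obtain ⟨rfl, hc⟩ := binary_node (c := c) (by omega)
    have h0 : c 0 ∈ treesInternal (c 0).numInternal (c 0).numInternal := ⟨hc 0, rfl⟩
    have h1 : c 1 ∈ treesInternal (c 1).numInternal (c 1).numInternal := ⟨hc 1, rfl⟩
    obtain ⟨l1, l2, l3⟩ := labelVertex_node_zero h0.1 h1.1
    obtain ⟨inj0, low0⟩ := ih 0 h0
    obtain ⟨inj1, low1⟩ := ih 1 h1
    have hsum : (node 0 c).numInternal = (c 0).numInternal + 1 + (c 1).numInternal := by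
      rw [numInternal_node_zero]; omega
    have hval : ∀ {N : ℕ} (β : Fin N → ℝ), treeVal β (node 0 c) =
        prefixSum β ((c 0).numInternal + 1 + (c 1).numInternal) -
          prefixSum β (c 0).numInternal - prefixSum β (c 1).numInternal := by
      intro N β
      rw [treeVal, hsum]
      have : ∑ j, prefixSum β (c j).numInternal =
        prefixSum β (c 0).numInternal + prefixSum β (c 1).numInternal := Fin.sum_univ_two _
      rw [this]
      ring
    rw [hsum] at hi
    subst hi
    clear hT hl hsum
    generalize (c 0).numInternal = a at *
    generalize (c 1).numInternal = b at *
    refine ⟨fun i hi j hj hij => ?_, fun i hi => ?_⟩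
    · rcases lt_split hi with hi' | rfl | ⟨i, hi', rfl⟩ <;>
        rcases lt_split hj with hj' | rfl | ⟨j, hj', rfl⟩
      · rw [l1 i hi', l1 j hj'] at hij
        exact inj0 i hi' j hj' (by simpa using hij)
      · rw [l1 i hi', l2] at hij; simp at hij
      · rw [l1 i hi', l3 j hj'] at hij; simp at hij
      · rw [l1 j hj', l2] at hij; simp at hij
      · rfl
      · rw [l2, l3 j hj'] at hij; simp at hij
      · rw [l1 j hj', l3 i hi'] at hij; simp at hij
      · rw [l2, l3 i hi'] at hij; simp at hij
      · rw [l3 i hi', l3 j hj'] at hij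
        rw [inj1 i hi' j hj' (by simpa using hij)]
    · rcases lt_split hi with hi' | rfl | ⟨i, hi', rfl⟩
      · obtain ⟨lo, hi, e1, e2, e3, e4, e5⟩ := low0 i hi'
        refine ⟨lo, hi, e1, e2, by omega, fun k hk => ?_, fun β => ?_⟩
        · rcases lt_split hk with hk' | rfl | ⟨k, hk', rfl⟩
          · rw [labelLE, l1 i hi', l1 k hk', List.cons_prefix_cons, ← e4 k hk', labelLE]
            simp
          · rw [labelLE, l1 i hi', l2]
            simp; omega
          · rw [labelLE, l1 i hi', l3 k hk']
            simp; omega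
        · rw [l1 i hi', ← e5 β]
          simp [subtreeAt]
      · refine ⟨0, i + b, by omega, by omega, by omega, fun k hk => ?_, fun β => ?_⟩
        · rw [labelLE, l2]
          simp; omega
        · rw [l2, subtreeAt, hval]
          congr 2 <;> congr 1 <;> omega
      · obtain ⟨lo, hi, e1, e2, e3, e4, e5⟩ := low1 i hi'
        refine ⟨a + 1 + lo, a + 1 + hi, by omega, by omega, by omega, fun k hk => ?_,
          fun β => ?_⟩
        · rcases lt_split hk with hk' | rfl | ⟨k, hk', rfl⟩
          · rw [labelLE, l3 i hi', l1 k hk']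
            simp; omega
          · rw [labelLE, l3 i hi', l2]
            simp; omega
          · rw [labelLE, l3 i hi', l3 k hk', List.cons_prefix_cons]
            have := e4 k hk'
            rw [labelLE] at this
            rw [this]
            simp
        · have e6 := e5 β
          rw [l3 i hi']
          have : a + 1 + hi + 1 - (a + 1 + lo) = hi + 1 - lo := by omega
          rw [this]
          have : a + 1 + i - (a + 1 + lo) = i - lo := by omega
          rw [this]
          have : a + 1 + hi - (a + 1 + i) = hi - i := by omega
          rw [this, ← e6]
          simp [subtreeAt]

theorem labelLE_antisymm {n : ℕ} {T : PlaneTree} (hT : T ∈ treesInternal n n) {i j : ℕ}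
    (hi : i < n) (hj : j < n) (h : T.labelLE i j) (h' : T.labelLE j i) : i = j :=
  (labelVertex_injOn_and_lowerSet hT).1 i hi j hj
    (List.IsPrefix.eq_of_length_le h' (List.IsPrefix.length_le h))

end PlaneTree

/-! ### Linear functionals on the Loday coefficients -/

/-- The sequence `β`, extended by zero. -/
def extZero {n : ℕ} (β : Fin n → ℝ) (k : ℕ) : ℝ := if h : k < n then β ⟨k, h⟩ else 0

theorem prefixSum_eq {n : ℕ} (β : Fin n → ℝ) (t : ℕ) :
    prefixSum β t = ∑ k ∈ Finset.range t, extZero β k := by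
  induction t with
  | zero => simp [prefixSum]
  | succ t ih =>
    rw [Finset.sum_range_succ, ← ih, prefixSum, prefixSum]
    by_cases h : t < n
    · have : Finset.univ.filter (fun k : Fin n => k.val < t + 1) =
          insert ⟨t, h⟩ (Finset.univ.filter fun k : Fin n => k.val < t) := by
        ext k
        simp [Fin.ext_iff]
        omega
      rw [this, Finset.sum_insert (by simp), extZero, dif_pos h, add_comm]
    · rw [extZero, dif_neg h, add_zero]
      congr 1
      ext k
      have := k.2
      simp
      omega

/-- The first differences of a sequence. -/
def firstDiff (b : ℕ → ℝ) : ℕ → ℝ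
  | 0 => b 0
  | k + 1 => b (k + 1) - b k

theorem sum_firstDiff_range (b : ℕ → ℝ) (s n : ℕ) :
    ∑ u ∈ Finset.range (n + 1), firstDiff b (s + 1 + u) = b (s + 1 + n) - b s := by
  induction n with
  | zero => simp [firstDiff]
  | succ n ih =>
    rw [Finset.sum_range_succ, ih, ← add_assoc, firstDiff]
    ring

theorem sum_firstDiff_range_zero (b : ℕ → ℝ) (n : ℕ) :
    ∑ u ∈ Finset.range (n + 1), firstDiff b u = b n := by
  induction n with
  | zero => simp [firstDiff]
  | succ n ih =>
    rw [Finset.sum_range_succ, ih, firstDiff]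
    ring

theorem sum_sum_firstDiff (b : ℕ → ℝ) (m n : ℕ) :
    ∑ s ∈ Finset.range (m + 1), ∑ u ∈ Finset.range (n + 1), firstDiff b (s + u) =
      ∑ k ∈ Finset.range (m + n + 1), b k - ∑ k ∈ Finset.range m, b k -
        ∑ k ∈ Finset.range n, b k := by
  induction m with
  | zero => simp [sum_firstDiff_range_zero, Finset.sum_range_succ_sub_sum]
  | succ m ih =>
    rw [Finset.sum_range_succ, ih, sum_firstDiff_range, show m + 1 + n + 1 = m + n + 1 + 1 by omega,
      Finset.sum_range_succ _ (m + n + 1), Finset.sum_range_succ _ m,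
      show m + 1 + n = m + n + 1 by omega]
    ring

theorem sum_Icc_firstDiff (b : ℕ → ℝ) {lo i hi : ℕ} (h1 : lo ≤ i) (h2 : i ≤ hi) :
    ∑ pq ∈ Finset.Icc lo i ×ˢ Finset.Icc i hi, firstDiff b (pq.2 - pq.1) =
      ∑ k ∈ Finset.range (hi + 1 - lo), b k - ∑ k ∈ Finset.range (i - lo), b k -
        ∑ k ∈ Finset.range (hi - i), b k := by
  obtain ⟨m, rfl⟩ := Nat.exists_eq_add_of_le h1
  obtain ⟨n, rfl⟩ := Nat.exists_eq_add_of_le h2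
  rw [show lo + m + n + 1 - lo = m + n + 1 by omega, show lo + m - lo = m by omega,
    show lo + m + n - (lo + m) = n by omega, ← sum_sum_firstDiff, ← Finset.sum_product']
  refine Finset.sum_bij' (fun pq _ => (lo + m - pq.1, pq.2 - (lo + m)))
    (fun su _ => (lo + m - su.1, lo + m + su.2)) ?_ ?_ ?_ ?_ ?_
  · rintro ⟨p, q⟩ h
    simp at h ⊢
    omega
  · rintro ⟨p, q⟩ h
    simp at h ⊢
    omega
  · rintro ⟨p, q⟩ h
    simp at h ⊢
    omega
  · rintro ⟨p, q⟩ h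
    simp at h ⊢
    omega
  · rintro ⟨p, q⟩ h
    simp at h ⊢
    congr 1
    omega

/-- The pairs `p ≤ q < d`, viewed as the nonempty intervals in `{0, …, d - 1}`. -/
def intervals (d : ℕ) : Finset (ℕ × ℕ) :=
  (Finset.range d ×ˢ Finset.range d).filter fun pq => pq.1 ≤ pq.2

theorem mem_intervals {d : ℕ} {pq : ℕ × ℕ} : pq ∈ intervals d ↔ pq.1 ≤ pq.2 ∧ pq.2 < d := by
  simp only [intervals, Finset.mem_filter, Finset.mem_product, Finset.mem_range]
  omega

/-- The maximum of `g` over an interval. -/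
def intervalMax (g : ℕ → ℝ) (pq : ℕ × ℕ) : ℝ :=
  if h : pq.1 ≤ pq.2 then (Finset.Icc pq.1 pq.2).sup' (Finset.nonempty_Icc.2 h) g else 0

theorem le_intervalMax {g : ℕ → ℝ} {pq : ℕ × ℕ} {i : ℕ} (h1 : pq.1 ≤ i) (h2 : i ≤ pq.2) :
    g i ≤ intervalMax g pq := by
  rw [intervalMax, dif_pos (h1.trans h2)]
  exact Finset.le_sup' g (Finset.mem_Icc.2 ⟨h1, h2⟩)

theorem intervalMax_le {g : ℕ → ℝ} {pq : ℕ × ℕ} {x : ℝ} (h : pq.1 ≤ pq.2)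
    (hx : ∀ i, pq.1 ≤ i → i ≤ pq.2 → g i ≤ x) : intervalMax g pq ≤ x := by
  rw [intervalMax, dif_pos h]
  exact Finset.sup'_le _ _ fun i hi => hx i (Finset.mem_Icc.1 hi).1 (Finset.mem_Icc.1 hi).2

/-- The maximum of the functional `g` over the Loday coefficients of all binary trees. -/
def lodayMax {d : ℕ} (β : Fin d → ℝ) (g : ℕ → ℝ) : ℝ :=
  ∑ pq ∈ intervals d, firstDiff (extZero β) (pq.2 - pq.1) * intervalMax g pq

/-- `g` increases weakly towards the root of `T`. -/
def Adapted (T : PlaneTree) (d : ℕ) (g : ℕ → ℝ) : Prop :=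
  ∀ i < d, ∀ j < d, T.labelLE i j → g i ≤ g j

theorem firstDiff_extZero_pos {d : ℕ} {β : Fin d → ℝ} (hβ : StrictMono β) {p q : ℕ} (hpq : p < q)
    (hq : q < d) : 0 < firstDiff (extZero β) (q - p) := by
  obtain ⟨k, rfl⟩ := Nat.exists_eq_add_of_lt hpq
  rw [show p + k + 1 - p = k + 1 by omega, firstDiff, extZero, extZero, dif_pos (by omega),
    dif_pos (by omega), sub_pos]
  exact hβ (by simp [Fin.lt_def])

theorem exists_top {d : ℕ} {T : PlaneTree} (hT : T ∈ trees d) :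
    ∃ top : ℕ × ℕ → ℕ, ∀ pq ∈ intervals d, pq.1 ≤ top pq ∧ top pq ≤ pq.2 ∧
      ∀ k, pq.1 ≤ k → k ≤ pq.2 → T.labelLE k (top pq) := by
  have : ∀ pq : ℕ × ℕ, ∃ m, pq ∈ intervals d → pq.1 ≤ m ∧ m ≤ pq.2 ∧
      ∀ k, pq.1 ≤ k → k ≤ pq.2 → T.labelLE k m := by
    intro pq
    by_cases h : pq ∈ intervals d
    · obtain ⟨m, hm⟩ := PlaneTree.exists_labelLE_of_le hT (mem_intervals.1 h).1 (mem_intervals.1 h).2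
      exact ⟨m, fun _ => hm⟩
    · exact ⟨0, fun h' => absurd h' h⟩
  choose top htop using this
  exact ⟨top, htop⟩

theorem sum_treeVal_mul {d : ℕ} (β : Fin d → ℝ) {T : PlaneTree} (hT : T ∈ treesInternal d d)
    {top : ℕ × ℕ → ℕ} (htop : ∀ pq ∈ intervals d, pq.1 ≤ top pq ∧ top pq ≤ pq.2 ∧
      ∀ k, pq.1 ≤ k → k ≤ pq.2 → T.labelLE k (top pq)) (g : ℕ → ℝ) :
    ∑ i ∈ Finset.range d, treeVal β (T.subtreeAt (T.labelVertex i)) * g i =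
      ∑ pq ∈ intervals d, firstDiff (extZero β) (pq.2 - pq.1) * g (top pq) := by
  have hmaps : ∀ pq ∈ intervals d, top pq ∈ Finset.range d := fun pq h =>
    Finset.mem_range.2 ((htop pq h).2.1.trans_lt (mem_intervals.1 h).2)
  rw [← Finset.sum_fiberwise_of_maps_to hmaps]
  refine Finset.sum_congr rfl fun i hi => ?_
  rw [Finset.mem_range] at hi
  obtain ⟨lo, hi', h1, h2, h3, h4, h5⟩ := (PlaneTree.labelVertex_injOn_and_lowerSet hT).2 i hi
  have hfib : (intervals d).filter (fun pq => top pq = i) =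
      Finset.Icc lo i ×ˢ Finset.Icc i hi' := by
    ext ⟨p, q⟩
    simp only [Finset.mem_filter, Finset.mem_product, Finset.mem_Icc]
    constructor
    · rintro ⟨h, rfl⟩
      obtain ⟨t1, t2, t3⟩ := htop _ h
      obtain ⟨m1, m2⟩ := mem_intervals.1 h
      dsimp only at *
      have hp := (h4 p (by omega)).1 (t3 p le_rfl m1)
      have hq := (h4 q m2).1 (t3 q m1 le_rfl)
      omega
    · rintro ⟨⟨hp1, hp2⟩, hq1, hq2⟩
      have hm : (p, q) ∈ intervals d := mem_intervals.2 ⟨by dsimp only; omega, by dsimp only; omega⟩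
      refine ⟨hm, ?_⟩
      obtain ⟨t1, t2, t3⟩ := htop _ hm
      dsimp only at *
      exact PlaneTree.labelLE_antisymm hT (by omega) hi
        ((h4 _ (by omega)).2 (by omega)) (t3 i hp2 hq1)
  rw [hfib, h5, prefixSum_eq, prefixSum_eq, prefixSum_eq, ← sum_Icc_firstDiff _ h1 h2,
    Finset.sum_mul]
  refine Finset.sum_congr rfl fun pq hpq => ?_
  rw [← hfib, Finset.mem_filter] at hpq
  rw [hpq.2]

theorem sum_treeVal_mul_le {d : ℕ} {β : Fin d → ℝ} (hβ : StrictMono β) {T : PlaneTree}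
    (hT : T ∈ treesInternal d d) (g : ℕ → ℝ) :
    ∑ i ∈ Finset.range d, treeVal β (T.subtreeAt (T.labelVertex i)) * g i ≤ lodayMax β g ∧
    (∑ i ∈ Finset.range d, treeVal β (T.subtreeAt (T.labelVertex i)) * g i = lodayMax β g ↔
      Adapted T d g) := by
  obtain ⟨top, htop⟩ := exists_top hT.1
  rw [sum_treeVal_mul β hT htop, lodayMax]
  have hdiag : ∀ pq ∈ intervals d, pq.1 = pq.2 → g (top pq) = intervalMax g pq := by
    rintro ⟨p, q⟩ h (rfl : p = q)
    obtain ⟨t1, t2, -⟩ := htop _ h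
    refine le_antisymm (le_intervalMax t1 t2) (intervalMax_le le_rfl fun i hi hi' => ?_)
    dsimp only at *
    rw [show i = top (p, p) by omega]
  have hle : ∀ pq ∈ intervals d, firstDiff (extZero β) (pq.2 - pq.1) * g (top pq) ≤
      firstDiff (extZero β) (pq.2 - pq.1) * intervalMax g pq := by
    intro pq h
    rcases (mem_intervals.1 h).1.eq_or_lt with he | hlt
    · rw [hdiag pq h he]
    · exact mul_le_mul_of_nonneg_left (le_intervalMax (htop pq h).1 (htop pq h).2.1)
        (firstDiff_extZero_pos hβ hlt (mem_intervals.1 h).2).le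
  refine ⟨Finset.sum_le_sum hle, ?_⟩
  rw [Finset.sum_eq_sum_iff_of_le hle]
  constructor
  · intro H i hi j hj hij
    rcases eq_or_ne i j with rfl | hne
    · exact le_rfl
    have hm : (min i j, max i j) ∈ intervals d :=
      mem_intervals.2 ⟨by dsimp only; omega, by dsimp only; omega⟩
    obtain ⟨t1, t2, t3⟩ := htop _ hm
    have htj : top (min i j, max i j) = j := by
      refine PlaneTree.labelLE_antisymm hT (by dsimp only at *; omega) hj ?_
        (t3 j (by dsimp only; omega) (by dsimp only; omega))
      exact PlaneTree.labelLE_of_between hT.1 hi hj hij t1 t2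
    have h := mul_left_cancel₀ (firstDiff_extZero_pos hβ (show min i j < max i j by omega)
      (by omega)).ne' (H _ hm)
    rw [htj] at h
    rw [h]
    exact le_intervalMax (by dsimp only; omega) (by dsimp only; omega)
  · intro H pq h
    obtain ⟨t1, t2, t3⟩ := htop _ h
    obtain ⟨m1, m2⟩ := mem_intervals.1 h
    congr 1
    exact le_antisymm (le_intervalMax t1 t2)
      (intervalMax_le m1 fun i hi hi' => H i (by omega) _ (by omega) (t3 i hi hi'))

/-- The order of the labels of a binary tree determines its coefficients. -/
theorem treeCoeff_congr {d : ℕ} (β : Fin d → ℝ) {T T' : PlaneTree} (hT : T ∈ treesInternal d d)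
    (hT' : T' ∈ treesInternal d d) (h : ∀ i < d, ∀ j < d, T'.labelLE i j → T.labelLE i j) :
    treeCoeff β T = treeCoeff β T' := by
  have h' : ∀ i < d, ∀ j < d, T.labelLE i j ↔ T'.labelLE i j := by
    refine fun i hi j hj => ⟨fun hij => ?_, h i hi j hj⟩
    obtain ⟨m, h1, h2, h3⟩ := PlaneTree.exists_labelLE_of_le hT'.1
      (show min i j ≤ max i j by omega) (by omega)
    have hm : T'.labelLE j m := h3 j (by omega) (by omega)
    have : m = j := PlaneTree.labelLE_antisymm hT (by omega) hj
      (PlaneTree.labelLE_of_between hT.1 hi hj hij h1 h2) (h j hj m (by omega) hm)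
    exact this ▸ h3 i (by omega) (by omega)
  funext i
  obtain ⟨lo, hi, h1, h2, h3, h4, h5⟩ := (PlaneTree.labelVertex_injOn_and_lowerSet hT).2 i i.2
  obtain ⟨lo', hi', h1', h2', h3', h4', h5'⟩ :=
    (PlaneTree.labelVertex_injOn_and_lowerSet hT').2 i i.2
  have key : ∀ k < d, (lo ≤ k ∧ k ≤ hi) ↔ (lo' ≤ k ∧ k ≤ hi') := fun k hk => by
    rw [← h4 k hk, ← h4' k hk, h' k hk i i.2]
  have k1 := key lo (by omega)
  have k2 := key hi (by omega)
  have k3 := key lo' (by omega)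
  have k4 := key hi' (by omega)
  obtain rfl : lo = lo' := by omega
  obtain rfl : hi = hi' := by omega
  rw [treeCoeff, treeCoeff, h5, h5']

theorem finite_treeCoeff {d : ℕ} (β : Fin d → ℝ) : (treeCoeff β '' treesInternal d d).Finite := by
  refine Set.Finite.subset (Set.Finite.pi' (t := fun i : Fin d => Set.range fun x :
    Fin d × Fin d => prefixSum β (x.2 + 1 - x.1) - prefixSum β (i - x.1) - prefixSum β (x.2 - i))
    fun i => Set.finite_range _) ?_
  rintro _ ⟨T, hT, rfl⟩ i
  obtain ⟨lo, hi, h1, h2, h3, h4, h5⟩ := (PlaneTree.labelVertex_injOn_and_lowerSet hT).2 i i.2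
  exact ⟨(⟨lo, by omega⟩, ⟨hi, h3⟩), (h5 β).symm⟩

/-! ### Block indices -/

namespace OrderedPartition

variable {n k : ℕ} (S : OrderedPartition n k)

/-- The index of the block that contains a given element. -/
noncomputable def blk (x : Fin n) : Fin k := (S.cover x).choose

theorem mem_block_iff {x : Fin n} {a : Fin k} : x ∈ S.block a ↔ S.blk x = a := by
  have h : x ∈ S.block (S.blk x) := (S.cover x).choose_spec
  constructor
  · intro hx
    by_contra hne
    exact Finset.disjoint_left.1 (S.disjoint _ _ hne) h hx
  · rintro rfl
    exact h

theorem blk_surjective : Function.Surjective S.blk := fun a => by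
  obtain ⟨x, hx⟩ := S.nonempty a
  exact ⟨x, S.mem_block_iff.1 hx⟩

theorem permPartition_refines_iff {π : Equiv.Perm (Fin n)} :
    (permPartition π).Refines S ↔ Monotone (S.blk ∘ π.symm) := by
  constructor
  · rintro ⟨f, hf, h⟩
    have : S.blk ∘ π.symm = f := by
      funext a
      exact S.mem_block_iff.1 (h a (by simp [permPartition]))
    rwa [this]
  · intro h
    refine ⟨_, h, fun a x hx => ?_⟩
    obtain rfl : x = π.symm a := by simpa [permPartition] using hx
    exact S.mem_block_iff.2 rfl

theorem blk_permPartition (π : Equiv.Perm (Fin n)) : (permPartition π).blk = π := by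
  funext x
  rw [← mem_block_iff]
  simp [permPartition]

end OrderedPartition

theorem typeEntry_eq_card {n m : ℕ} (S : OrderedPartition n (m + 1)) (π : Equiv.Perm (Fin n))
    (a : Fin m) : S.typeEntry a =
      (Finset.univ.filter fun i => (S.blk ∘ π.symm) i ≤ a.castSucc).card := by
  have h1 : (Finset.univ.filter fun i => (S.blk ∘ π.symm) i ≤ a.castSucc).card =
      (Finset.univ.filter fun x => S.blk x ≤ a.castSucc).card := by
    refine Finset.card_bij (fun i _ => π.symm i) ?_ ?_ ?_
    · simp
    · simp
    · intro x hx
      exact ⟨π x, by simpa using hx, by simp⟩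
  rw [h1, OrderedPartition.typeEntry]
  rw [Finset.card_eq_sum_card_fiberwise (f := S.blk)
    (t := Finset.univ.filter fun b : Fin (m + 1) => b.val ≤ a.val)]
  · refine Finset.sum_congr rfl fun b hb => ?_
    congr 1
    ext x
    simp only [Finset.mem_filter, Finset.mem_univ, true_and] at hb ⊢
    rw [S.mem_block_iff]
    constructor
    · rintro rfl
      exact ⟨hb, rfl⟩
    · exact fun h => h.2
  · intro x hx
    simpa [Fin.le_def] using hx

section TypeEntry

variable {d m : ℕ} {S : OrderedPartition (d + 1) (m + 1)} {π : Equiv.Perm (Fin (d + 1))}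

theorem lt_typeEntry_iff (hπ : Monotone (S.blk ∘ π.symm)) (a : Fin m) (i : Fin (d + 1)) :
    i.val < S.typeEntry a ↔ S.blk (π.symm i) ≤ a.castSucc := by
  rw [typeEntry_eq_card S π]
  exact Tuple.lt_card_le_iff_apply_le_of_monotone hπ

theorem typeEntry_eq_iff (hπ : Monotone (S.blk ∘ π.symm)) (a : Fin m) (i : Fin d) :
    S.typeEntry a = i.val + 1 ↔
      S.blk (π.symm i.castSucc) = a.castSucc ∧ S.blk (π.symm i.succ) = a.succ := by
  have h1 := lt_typeEntry_iff hπ a i.castSucc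
  have h2 := lt_typeEntry_iff hπ a i.succ
  simp only [Fin.val_castSucc, Fin.val_succ] at h1 h2
  constructor
  · intro h
    rw [h] at h1 h2
    have h1' := h1.1 (by omega)
    have h2' : a.castSucc < S.blk (π.symm i.succ) := not_le.1 fun h' => by
      have := h2.2 h'
      omega
    constructor
    · refine le_antisymm h1' ?_
      obtain ⟨x, hx⟩ := S.blk_surjective a.castSucc
      rcases le_or_gt (π x) i.castSucc with hle | hlt
      · have := hπ hle
        simpa [hx] using this
      · have := hπ (Fin.castSucc_lt_iff_succ_le.1 hlt)
        simp only [Function.comp_apply, Equiv.symm_apply_apply, hx] at this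
        exact absurd this h2'.not_ge
    · refine le_antisymm ?_ (Fin.castSucc_lt_iff_succ_le.1 h2')
      obtain ⟨x, hx⟩ := S.blk_surjective a.succ
      rcases le_or_gt (π x) i.castSucc with hle | hlt
      · have := hπ hle
        simp only [Function.comp_apply, Equiv.symm_apply_apply, hx] at this
        exact absurd (this.trans h1') (Fin.castSucc_lt_succ).not_ge
      · have := hπ (Fin.castSucc_lt_iff_succ_le.1 hlt)
        simpa [hx] using this
  · rintro ⟨e1, e2⟩
    rw [e1] at h1
    rw [e2] at h2
    have h1' := h1.2 le_rfl
    have h2' : ¬ i.val + 1 < S.typeEntry a := fun h => (Fin.castSucc_lt_succ).not_ge (h2.1 h)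
    omega

theorem exists_typeEntry_eq (hπ : Monotone (S.blk ∘ π.symm)) (a : Fin m) :
    ∃ i : Fin d, S.typeEntry a = i.val + 1 := by
  obtain ⟨x, hx⟩ := S.blk_surjective a.castSucc
  obtain ⟨y, hy⟩ := S.blk_surjective a.succ
  have h1 := (lt_typeEntry_iff hπ a (π x)).2 (by simp [hx])
  have h2 : ¬ (π y).val < S.typeEntry a := fun h => by
    have := (lt_typeEntry_iff hπ a (π y)).1 h
    rw [Equiv.symm_apply_apply, hy] at this
    exact (Fin.castSucc_lt_succ).not_ge this
  have := (π y).2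
  exact ⟨⟨S.typeEntry a - 1, by omega⟩, by dsimp only; omega⟩

end TypeEntry

/-! ### The cones in terms of gaps -/

/-- The difference of the entries `i + 1` and `i` of a finite sequence. -/
def gap {m : ℕ} (u : Fin (m + 1) → ℝ) (i : ℕ) : ℝ :=
  if h : i < m then u ⟨i + 1, by omega⟩ - u ⟨i, by omega⟩ else 0

theorem gap_val {m : ℕ} (u : Fin (m + 1) → ℝ) (i : Fin m) :
    gap u i = u i.succ - u i.castSucc := by
  rw [gap, dif_pos i.2]
  rfl

theorem gap_nonneg {m : ℕ} {u : Fin (m + 1) → ℝ} (hu : Monotone u) (i : ℕ) : 0 ≤ gap u i := by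
  rw [gap]
  split_ifs
  · exact sub_nonneg.2 (hu (by simp [Fin.le_def]))
  · exact le_rfl

theorem monotone_of_gap_nonneg {m : ℕ} {u : Fin (m + 1) → ℝ} (h : ∀ i : Fin m, 0 ≤ gap u i) :
    Monotone u := by
  refine Fin.monotone_iff_le_succ.2 fun i => ?_
  have := h i
  rw [gap_val] at this
  linarith

theorem strictMono_of_gap_pos {m : ℕ} {u : Fin (m + 1) → ℝ} (h : ∀ i : Fin m, 0 < gap u i) :
    StrictMono u := by
  refine Fin.strictMono_iff_lt_succ.2 fun i => ?_
  have := h i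
  rw [gap_val] at this
  linarith

theorem coordDiff_mk {d : ℕ} (i j : Fin (d + 1)) (w : Fin (d + 1) → ℝ) :
    coordDiff i j (Submodule.Quotient.mk w) = w j - w i := rfl

theorem D_mk {d : ℕ} (π : Equiv.Perm (Fin (d + 1))) (i : Fin d) (w : Fin (d + 1) → ℝ) :
    D π i (Submodule.Quotient.mk w) = gap (w ∘ π.symm) i := by
  rw [gap_val]
  rfl

theorem PartitionLabeledTree.mk_mem_cone_iff {d : ℕ} (X : PartitionLabeledTree d)
    (w : Fin (d + 1) → ℝ) : (Submodule.Quotient.mk w : W d) ∈ X.cone ↔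
      ∃ u : Fin (X.m + 1) → ℝ, (∀ x, w x = u (X.partition.blk x)) ∧
        Adapted X.tree X.m (gap u) ∧ Monotone u := by
  constructor
  · rintro ⟨hblk, π, hπ, hle, hmin⟩
    rw [OrderedPartition.permPartition_refines_iff] at hπ
    obtain ⟨r, hr⟩ := X.partition.blk_surjective.hasRightInverse
    have hw : ∀ x, w x = w (r (X.partition.blk x)) := fun x => by
      have := hblk _ (r (X.partition.blk x)) (X.partition.mem_block_iff.2 (hr _)) x
        (X.partition.mem_block_iff.2 rfl)
      rw [coordDiff_mk] at this
      linarith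
    have hD : ∀ (a : Fin X.m) (i : Fin d), X.partition.typeEntry a = i.val + 1 →
        D π i (Submodule.Quotient.mk w) = gap (w ∘ r) a := fun a i h => by
      obtain ⟨e1, e2⟩ := (typeEntry_eq_iff hπ a i).1 h
      rw [D_mk, gap_val, gap_val]
      simp only [Function.comp_apply]
      rw [hw (π.symm i.succ), hw (π.symm i.castSucc), e1, e2]
    have hAd : Adapted X.tree X.m (gap (w ∘ r)) := by
      intro a ha b hb hab
      obtain ⟨i, hi⟩ := exists_typeEntry_eq hπ ⟨a, ha⟩
      obtain ⟨j, hj⟩ := exists_typeEntry_eq hπ ⟨b, hb⟩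
      have := hle i j ⟨_, _, hi, hj, hab⟩
      rwa [hD _ _ hi, hD _ _ hj] at this
    refine ⟨w ∘ r, hw, hAd, monotone_of_gap_nonneg fun a => ?_⟩
    classical
    obtain ⟨a', ha', hmax⟩ := Finset.exists_max_image
      (Finset.univ.filter fun a' : Fin X.m => X.tree.labelLE a' a)
      (fun a' => (X.tree.labelVertex a').length)
      ⟨a, by simpa using X.tree.labelLE_refl a⟩
    simp only [Finset.mem_filter, Finset.mem_univ, true_and] at ha' hmax
    obtain ⟨i, hi⟩ := exists_typeEntry_eq hπ a'
    have h0 : X.IsMinimalType i := by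
      refine ⟨⟨a', hi⟩, ?_⟩
      rintro j ⟨c, b, hc, hb, hcb⟩
      obtain rfl : b = a' := by
        have e1 := ((typeEntry_eq_iff hπ b i).1 hb).1
        have e2 := ((typeEntry_eq_iff hπ a' i).1 hi).1
        exact Fin.castSucc_injective _ (e1.symm.trans e2)
      exact ⟨b, c, hb, hc, PlaneTree.labelVertex_eq_of_length_eq hcb
        (hmax c (PlaneTree.labelLE_trans hcb ha'))⟩
    have := hmin i h0
    rw [hD _ _ hi] at this
    exact this.trans (hAd a' a'.2 a a.2 ha')
  · rintro ⟨u, hw, hAd, hmono⟩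
    refine ⟨fun a i hi j hj => ?_, ?_⟩
    · rw [OrderedPartition.mem_block_iff] at hi hj
      rw [coordDiff_mk, hw, hw, hi, hj, sub_self]
    · have hπ : Monotone (X.partition.blk ∘ (Tuple.sort X.partition.blk)) := Tuple.monotone_sort _
      refine ⟨(Tuple.sort X.partition.blk).symm,
        X.partition.permPartition_refines_iff.2 hπ, ?_, ?_⟩
      · rintro i j ⟨a, b, ha, hb, hab⟩
        obtain ⟨e1, e2⟩ := (typeEntry_eq_iff (π := (Tuple.sort X.partition.blk).symm) hπ a i).1 ha
        obtain ⟨e3, e4⟩ := (typeEntry_eq_iff (π := (Tuple.sort X.partition.blk).symm) hπ b j).1 hb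
        have := hAd a a.2 b b.2 hab
        rw [D_mk, D_mk, gap_val, gap_val]
        rw [gap_val, gap_val] at this
        simp only [Function.comp_apply]
        rwa [hw, hw, hw, hw, e1, e2, e3, e4]
      · intro i _
        rw [D, coordDiff_mk, hw, hw]
        exact sub_nonneg.2 (hmono (hπ (Fin.castSucc_lt_succ).le))

theorem mk_mem_permCone_iff {d : ℕ} {π : Equiv.Perm (Fin (d + 1))} {T : PlaneTree}
    (hT : T ∈ trees d) (w : Fin (d + 1) → ℝ) :
    (Submodule.Quotient.mk w : W d) ∈ permCone π T hT ↔
      Monotone (w ∘ π.symm) ∧ Adapted T d (gap (w ∘ π.symm)) := by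
  rw [permCone, PartitionLabeledTree.mk_mem_cone_iff]
  simp only [OrderedPartition.blk_permPartition]
  constructor
  · rintro ⟨u, hu, hA, hm⟩
    have : w ∘ π.symm = u := by
      funext i
      simp [hu]
    rw [this]
    exact ⟨hm, hA⟩
  · rintro ⟨hm, hA⟩
    exact ⟨w ∘ π.symm, fun x => by simp, hA, hm⟩

/-! ### Maximizing a functional over the points `v_{π,T}` -/

/-- `w ∘ π⁻¹` is sorted and its gaps increase towards the root of `T`. -/
def SortedAdapted {d : ℕ} (w : Fin (d + 1) → ℝ) (π : Equiv.Perm (Fin (d + 1))) (T : PlaneTree) :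
    Prop :=
  Monotone (w ∘ π.symm) ∧ Adapted T d (gap (w ∘ π.symm))

theorem vpt_apply_symm {d : ℕ} (α : Fin (d + 1) → ℝ) (β : Fin d → ℝ)
    (π : Equiv.Perm (Fin (d + 1))) (T : PlaneTree) (j : Fin (d + 1)) :
    vpt α β π T (π.symm j) = vpt α β 1 T j := by
  have h1 : ∀ i, (1 : Equiv.Perm (Fin (d + 1))).symm i = i := fun _ => rfl
  simp [vpt, fvec, Pi.single_apply, Finset.sum_apply, h1]

theorem sum_mul_vpt {d : ℕ} (α : Fin (d + 1) → ℝ) (β : Fin d → ℝ) (π : Equiv.Perm (Fin (d + 1)))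
    (T : PlaneTree) (w : Fin (d + 1) → ℝ) :
    ∑ x, w x * vpt α β π T x = ∑ i, α i * w (π.symm i) +
      ∑ i ∈ Finset.range d, treeVal β (T.subtreeAt (T.labelVertex i)) * gap (w ∘ π.symm) i := by
  have h1 : ∀ i, ∑ x, w x * (α i * (Pi.single (π.symm i) 1 : Fin (d + 1) → ℝ) x) =
      α i * w (π.symm i) := fun i => by
    simp [Pi.single_apply, mul_comm]
  have h2 : ∀ i : Fin d, ∑ x, w x * (treeCoeff β T i * fvec π i x) =
      treeCoeff β T i * gap (w ∘ π.symm) i := fun i => by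
    simp [fvec, gap_val, Pi.single_apply, mul_sub, Finset.sum_sub_distrib]
    ring
  rw [Finset.sum_range]
  simp only [vpt, Pi.add_apply, Finset.sum_apply, Pi.smul_apply, smul_eq_mul, mul_add,
    Finset.mul_sum, Finset.sum_add_distrib]
  rw [Finset.sum_comm, Finset.sum_comm (s := Finset.univ (α := Fin (d + 1)))
    (t := Finset.univ (α := Fin d))]
  simp only [h1, h2]
  rfl

theorem sum_mul_vpt_eq_sum_coeff {d : ℕ} (α : Fin (d + 1) → ℝ) (β : Fin d → ℝ)
    (π : Equiv.Perm (Fin (d + 1))) (T : PlaneTree) (w : Fin (d + 1) → ℝ) :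
    ∑ x, w x * vpt α β π T x = ∑ i, vpt α β 1 T i * (w ∘ π.symm) i := by
  rw [← Equiv.sum_comp π.symm]
  refine Finset.sum_congr rfl fun i _ => ?_
  rw [vpt_apply_symm, mul_comm, Function.comp_apply]

/-- The maximum of the functional `w` over the nested permuto-associahedron. -/
noncomputable def supportValue {d : ℕ} (α : Fin (d + 1) → ℝ) (β : Fin d → ℝ)
    (w : Fin (d + 1) → ℝ) : ℝ :=
  ∑ i, α i * w (Tuple.sort w i) + lodayMax β (gap (w ∘ Tuple.sort w))

section Support

variable {d : ℕ} {α : Fin (d + 1) → ℝ} {β : Fin d → ℝ}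

theorem sum_mul_vpt_le_sort (hαβ : IsTreeAppropriate α β) (π : Equiv.Perm (Fin (d + 1)))
    {T : PlaneTree} (hT : T ∈ treesInternal d d) (w : Fin (d + 1) → ℝ) :
    ∑ x, w x * vpt α β π T x ≤ ∑ x, w x * vpt α β (Tuple.sort w).symm T x ∧
      (∑ x, w x * vpt α β π T x = ∑ x, w x * vpt α β (Tuple.sort w).symm T x ↔
        Monotone (w ∘ π.symm)) := by
  have hc : StrictMono (vpt α β 1 T) := by
    have := hαβ.strictMono_coeff T hT 1
    exact this
  have hmv : Monovary (vpt α β 1 T) (w ∘ Tuple.sort w) :=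
    hc.monotone.monovary (Tuple.monotone_sort w)
  have hcomp : w ∘ π.symm = (w ∘ Tuple.sort w) ∘ (π.symm.trans (Tuple.sort w).symm) := by
    funext i
    simp
  rw [sum_mul_vpt_eq_sum_coeff, sum_mul_vpt_eq_sum_coeff, hcomp]
  refine ⟨hmv.sum_mul_comp_perm_le_sum_mul, ?_⟩
  refine Iff.trans hmv.sum_mul_comp_perm_eq_sum_mul_iff ?_
  constructor
  · intro h i j hij
    rcases hij.eq_or_lt with rfl | hlt
    · exact le_rfl
    · by_contra hcon
      exact absurd (h (not_le.1 hcon)) (hc hlt).not_ge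
  · intro h
    exact hc.monotone.monovary h

theorem sum_mul_vpt_le (hαβ : IsTreeAppropriate α β) (π : Equiv.Perm (Fin (d + 1)))
    {T : PlaneTree} (hT : T ∈ treesInternal d d) (w : Fin (d + 1) → ℝ) :
    ∑ x, w x * vpt α β π T x ≤ supportValue α β w ∧
      (∑ x, w x * vpt α β π T x = supportValue α β w ↔ SortedAdapted w π T) := by
  obtain ⟨h1, h2⟩ := sum_mul_vpt_le_sort hαβ π hT w
  obtain ⟨h3, h4⟩ := sum_treeVal_mul_le hαβ.strictMono_snd hT (gap (w ∘ Tuple.sort w))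
  have h5 := sum_mul_vpt α β (Tuple.sort w).symm T w
  rw [Equiv.symm_symm] at h5
  rw [supportValue]
  refine ⟨by linarith, ?_⟩
  constructor
  · intro h
    have hm : Monotone (w ∘ π.symm) := h2.1 (by linarith)
    refine ⟨hm, ?_⟩
    rw [Tuple.unique_monotone hm (Tuple.monotone_sort w)]
    exact h4.1 (by linarith)
  · rintro ⟨hm, hA⟩
    rw [Tuple.unique_monotone hm (Tuple.monotone_sort w)] at hA
    rw [h2.2 hm, h5, h4.2 hA]

end Support

/-! ### Relative interior points of the cones -/

theorem exists_adapted {d : ℕ} (g : ℕ → ℝ) (b : ℕ) :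
    ∃ T ∈ treesInternal d d, Adapted T d g ∧
      (b < d → ∀ a < d, (∀ m, min a b ≤ m → m ≤ max a b → g m ≤ g b) → T.labelLE a b) := by
  obtain ⟨T, hT, hA, hb⟩ := PlaneTree.exists_strictlyAdapted d
    fun m => toLex (g m, if m = b then d else m)
  have hinj : Set.InjOn (fun m => toLex (g m, if m = b then d else m)) (Set.Iio d) := by
    intro x hx y hy hxy
    simp only [toLex_inj, Prod.mk.injEq] at hxy
    rw [Set.mem_Iio] at hx hy
    have := hxy.2
    split_ifs at this <;> omega
  refine ⟨T, ⟨hT, hb hinj⟩, fun i hi j hj hij => ?_, fun hbd a ha hab => ?_⟩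
  · have := (hA i hi j hj hij).1
    rcases Prod.Lex.le_iff.1 this with h | h
    · exact h.le
    · exact h.1.le
  · obtain ⟨m, h1, h2, h3⟩ := PlaneTree.exists_labelLE_of_le hT (show min a b ≤ max a b by omega)
      (by omega)
    have hbm := (hA b hbd m (by omega) (h3 b (by omega) (by omega))).1
    have : m = b := by
      by_contra hne
      rcases Prod.Lex.le_iff.1 hbm with h | h
      · exact absurd (hab m h1 h2) (not_le.2 h)
      · have := h.2
        simp [hne] at this
        omega
    exact this ▸ h3 a (by omega) (by omega)

theorem exists_sortedAdapted {d : ℕ} (w : Fin (d + 1) → ℝ) :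
    ∃ π, ∃ T ∈ treesInternal d d, SortedAdapted w π T := by
  obtain ⟨T, hT, hA, -⟩ := exists_adapted (d := d) (gap (w ∘ Tuple.sort w)) 0
  exact ⟨(Tuple.sort w).symm, T, hT, Tuple.monotone_sort w, hA⟩

section Positions

variable {d m : ℕ} {S : OrderedPartition (d + 1) (m + 1)} {π : Equiv.Perm (Fin (d + 1))}

theorem typeEntry_lt (hπ : Monotone (S.blk ∘ π.symm)) {a b : Fin m} {i j : Fin d}
    (hi : S.typeEntry a = i.val + 1) (hj : S.typeEntry b = j.val + 1) (hab : a < b) : i < j := by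
  by_contra h
  have h' : j.succ ≤ i.succ := Fin.succ_le_succ_iff.2 (not_lt.1 h)
  have := hπ h'
  simp only [Function.comp_apply] at this
  rw [((typeEntry_eq_iff hπ a i).1 hi).2, ((typeEntry_eq_iff hπ b j).1 hj).2] at this
  exact absurd (Fin.succ_le_succ_iff.1 this) hab.not_ge

theorem typeEntry_le_iff (hπ : Monotone (S.blk ∘ π.symm)) {a b : Fin m} {i j : Fin d}
    (hi : S.typeEntry a = i.val + 1) (hj : S.typeEntry b = j.val + 1) : a ≤ b ↔ i ≤ j := by
  constructor
  · intro h
    rcases h.eq_or_lt with rfl | h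
    · exact (Fin.ext (by omega)).le
    · exact (typeEntry_lt hπ hi hj h).le
  · intro h
    by_contra h'
    exact absurd (typeEntry_lt hπ hj hi (not_le.1 h')) h.not_gt

theorem blk_eq_or_exists_typeEntry (hπ : Monotone (S.blk ∘ π.symm)) (i : Fin d) :
    S.blk (π.symm i.castSucc) = S.blk (π.symm i.succ) ∨
      ∃ a : Fin m, S.typeEntry a = i.val + 1 := by
  have hle : S.blk (π.symm i.castSucc) ≤ S.blk (π.symm i.succ) :=
    hπ (Fin.castSucc_lt_succ).le
  rcases hle.eq_or_lt with h | h
  · exact Or.inl h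
  right
  have hlt : (S.blk (π.symm i.castSucc)).val < m := by
    have := (S.blk (π.symm i.succ)).2
    rw [Fin.lt_def] at h
    omega
  set a : Fin m := ⟨_, hlt⟩ with ha
  have hac : S.blk (π.symm i.castSucc) = a.castSucc := rfl
  refine ⟨a, ?_⟩
  have h1 := (lt_typeEntry_iff hπ a i.castSucc).2 hac.le
  have h2 := fun h' => (lt_typeEntry_iff hπ a i.succ).1 h'
  rw [hac] at h
  have h3 : ¬ i.succ.val < S.typeEntry a := fun h' => absurd (h2 h') h.not_ge
  simp at h1 h3
  omega

theorem gap_comp_symm (hπ : Monotone (S.blk ∘ π.symm)) {w : Fin (d + 1) → ℝ}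
    {u : Fin (m + 1) → ℝ} (hw : ∀ x, w x = u (S.blk x)) {a : Fin m} {i : Fin d}
    (hi : S.typeEntry a = i.val + 1) : gap (w ∘ π.symm) i = gap u a := by
  obtain ⟨e1, e2⟩ := (typeEntry_eq_iff hπ a i).1 hi
  rw [gap_val, gap_val, Function.comp_apply, Function.comp_apply, hw, hw, e1, e2]

theorem gap_comp_symm_eq_zero {w : Fin (d + 1) → ℝ}
    {u : Fin (m + 1) → ℝ} (hw : ∀ x, w x = u (S.blk x)) {i : Fin d}
    (hi : S.blk (π.symm i.castSucc) = S.blk (π.symm i.succ)) : gap (w ∘ π.symm) i = 0 := by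
  rw [gap_val, Function.comp_apply, Function.comp_apply, hw, hw, hi, sub_self]

end Positions

/-- `w` lies in the relative interior of `σ(𝒮,T)`. -/
def PartitionLabeledTree.IsInterior {d : ℕ} (X : PartitionLabeledTree d) (w : Fin (d + 1) → ℝ) :
    Prop :=
  ∃ u : Fin (X.m + 1) → ℝ, (∀ x, w x = u (X.partition.blk x)) ∧ StrictMono u ∧
    X.tree.StrictlyAdapted X.m (gap u)

namespace PartitionLabeledTree

variable {d : ℕ} {X : PartitionLabeledTree d} {w₀ w : Fin (d + 1) → ℝ}

theorem sortedAdapted_of_mem_cone (hX : X.IsInterior w₀)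
    (hw : (Submodule.Quotient.mk w : W d) ∈ X.cone) {π : Equiv.Perm (Fin (d + 1))} {T : PlaneTree}
    (h₀ : SortedAdapted w₀ π T) (hT : T ∈ treesInternal d d) : SortedAdapted w π T := by
  obtain ⟨u₀, hu₀, hmono₀, hA₀⟩ := hX
  obtain ⟨u, hu, hA, hmono⟩ := (X.mk_mem_cone_iff w).1 hw
  have hπ : Monotone (X.partition.blk ∘ π.symm) := by
    intro i j hij
    have := h₀.1 hij
    simp only [Function.comp_apply, hu₀] at this
    exact hmono₀.le_iff_le.1 this
  have hm : Monotone (w ∘ π.symm) := by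
    intro i j hij
    simp only [Function.comp_apply, hu]
    exact hmono (hπ hij)
  refine ⟨hm, fun i hi j hj hij => ?_⟩
  have hle₀ := h₀.2 i hi j hj hij
  obtain ⟨i, rfl⟩ : ∃ i' : Fin d, i'.val = i := ⟨⟨i, hi⟩, rfl⟩
  obtain ⟨j, rfl⟩ : ∃ j' : Fin d, j'.val = j := ⟨⟨j, hj⟩, rfl⟩
  rcases blk_eq_or_exists_typeEntry hπ i with h | ⟨a, ha⟩
  · rw [gap_comp_symm_eq_zero hu h]
    exact gap_nonneg hm j
  have hpos : 0 < gap u₀ a := by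
    rw [gap_val, sub_pos]
    exact hmono₀ Fin.castSucc_lt_succ
  rw [gap_comp_symm hπ hu₀ ha] at hle₀
  rcases blk_eq_or_exists_typeEntry hπ j with h | ⟨b, hb⟩
  · rw [gap_comp_symm_eq_zero hu₀ h] at hle₀
    exact absurd hle₀ hpos.not_ge
  rw [gap_comp_symm hπ hu ha, gap_comp_symm hπ hu hb]
  obtain ⟨m, h1, h2, h3⟩ := PlaneTree.exists_labelLE_of_le X.tree_mem
    (show min a.val b.val ≤ max a.val b.val by omega) (by omega)
  have hmX : m < X.m := by omega
  obtain ⟨k, hk⟩ := exists_typeEntry_eq hπ ⟨m, hmX⟩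
  have hkj : T.labelLE k j := by
    have e1 := typeEntry_le_iff hπ ha hk
    have e2 := typeEntry_le_iff hπ hk ha
    have e3 := typeEntry_le_iff hπ hb hk
    have e4 := typeEntry_le_iff hπ hk hb
    simp only [Fin.le_def] at e1 e2 e3 e4
    exact PlaneTree.labelLE_of_between hT.1 i.2 j.2 hij (by omega) (by omega)
  have hle := h₀.2 k k.2 j j.2 hkj
  rw [gap_comp_symm hπ hu₀ hk, gap_comp_symm hπ hu₀ hb] at hle
  have hmb := (hA₀ b b.2 m hmX (h3 b (by omega) (by omega))).2 hle
  exact hA a a.2 b b.2 (PlaneTree.labelLE_trans (h3 a (by omega) (by omega)) hmb)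

theorem mem_cone_of_forall_sortedAdapted (hX : X.IsInterior w₀)
    (h : ∀ π, ∀ T ∈ treesInternal d d, SortedAdapted w₀ π T → SortedAdapted w π T) :
    (Submodule.Quotient.mk w : W d) ∈ X.cone := by
  obtain ⟨u₀, hu₀, hmono₀, hA₀⟩ := hX
  have hsort : ∀ π : Equiv.Perm (Fin (d + 1)), Monotone (X.partition.blk ∘ π.symm) →
      Monotone (w₀ ∘ π.symm) := by
    intro π hπ i j hij
    simp only [Function.comp_apply, hu₀]
    exact hmono₀.monotone (hπ hij)
  have hblk : ∀ x y, X.partition.blk x = X.partition.blk y → w x ≤ w y := by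
    intro x y hxy
    rcases eq_or_ne x y with rfl | hne
    · exact le_rfl
    obtain ⟨f, hf⟩ : ∃ f : Fin (d + 1) → ℕ,
        ∀ z, f z = 2 * (X.partition.blk z).val + if z = y then 1 else 0 := ⟨_, fun _ => rfl⟩
    have hfs : Monotone (f ∘ Tuple.sort f) := Tuple.monotone_sort f
    have hπ : Monotone (X.partition.blk ∘ (Tuple.sort f).symm.symm) := by
      intro i j hij
      have := hfs hij
      simp only [Function.comp_apply, hf] at this
      rw [Fin.le_def]
      simp only [Function.comp_apply, Equiv.symm_symm]
      split_ifs at this <;> omega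
    obtain ⟨T, hT, hA, -⟩ := exists_adapted (d := d) (gap (w₀ ∘ (Tuple.sort f).symm.symm)) 0
    have hw := (h _ T hT ⟨hsort _ hπ, hA⟩).1
    have hxy' : (Tuple.sort f).symm x ≤ (Tuple.sort f).symm y := by
      by_contra hcon
      have := hfs (not_le.1 hcon).le
      simp [hf, hne, hxy] at this
    simpa using hw hxy'
  obtain ⟨r, hr⟩ := X.partition.blk_surjective.hasRightInverse
  have hu : ∀ x, w x = (w ∘ r) (X.partition.blk x) := fun x =>
    le_antisymm (hblk _ _ (hr _).symm) (hblk _ _ (hr _))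
  set π : Equiv.Perm (Fin (d + 1)) := (Tuple.sort X.partition.blk).symm with hπdef
  have hπ : Monotone (X.partition.blk ∘ π.symm) := Tuple.monotone_sort X.partition.blk
  have hm₀ := hsort π hπ
  rw [X.mk_mem_cone_iff]
  refine ⟨w ∘ r, hu, fun a ha b hb hab => ?_, fun a b hab => ?_⟩
  · obtain ⟨a, rfl⟩ : ∃ a' : Fin X.m, a'.val = a := ⟨⟨a, ha⟩, rfl⟩
    obtain ⟨b, rfl⟩ : ∃ b' : Fin X.m, b'.val = b := ⟨⟨b, hb⟩, rfl⟩
    obtain ⟨i, hi⟩ := exists_typeEntry_eq hπ a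
    obtain ⟨j, hj⟩ := exists_typeEntry_eq hπ b
    obtain ⟨T, hT, hA, hT'⟩ := exists_adapted (d := d) (gap (w₀ ∘ π.symm)) j
    have hij : T.labelLE i j := by
      refine hT' j.2 i i.2 fun k hk1 hk2 => ?_
      obtain ⟨k, rfl⟩ : ∃ k' : Fin d, k'.val = k := ⟨⟨k, by omega⟩, rfl⟩
      rcases blk_eq_or_exists_typeEntry hπ k with hk | ⟨c, hc⟩
      · rw [gap_comp_symm_eq_zero hu₀ hk]
        exact gap_nonneg hm₀ j
      · rw [gap_comp_symm hπ hu₀ hc, gap_comp_symm hπ hu₀ hj]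
        have e1 := typeEntry_le_iff hπ hi hc
        have e2 := typeEntry_le_iff hπ hc hi
        have e3 := typeEntry_le_iff hπ hj hc
        have e4 := typeEntry_le_iff hπ hc hj
        simp only [Fin.le_def] at e1 e2 e3 e4
        exact (hA₀ c c.2 b b.2 (PlaneTree.labelLE_of_between X.tree_mem a.2 b.2 hab
          (by omega) (by omega))).1
    have := (h π T hT ⟨hm₀, hA⟩).2 i i.2 j j.2 hij
    rwa [gap_comp_symm hπ hu hi, gap_comp_symm hπ hu hj] at this
  · rcases hab.eq_or_lt with rfl | hlt
    · exact le_rfl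
    obtain ⟨T, hT, hA, -⟩ := exists_adapted (d := d) (gap (w₀ ∘ π.symm)) 0
    have hw := (h π T hT ⟨hm₀, hA⟩).1
    have : π (r a) ≤ π (r b) := by
      by_contra hcon
      have := hπ (not_le.1 hcon).le
      simp only [Function.comp_apply, Equiv.symm_apply_apply, hr _] at this
      exact absurd this hlt.not_ge
    simpa using hw this

theorem mk_mem_cone_iff_forall (hX : X.IsInterior w₀) :
    (Submodule.Quotient.mk w : W d) ∈ X.cone ↔
      ∀ π, ∀ T ∈ treesInternal d d, SortedAdapted w₀ π T → SortedAdapted w π T :=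
  ⟨fun hw _ _ hT h₀ => sortedAdapted_of_mem_cone hX hw h₀ hT, mem_cone_of_forall_sortedAdapted hX⟩

theorem exists_isInterior (X : PartitionLabeledTree d) : ∃ w₀, X.IsInterior w₀ := by
  set u : Fin (X.m + 1) → ℝ := fun a =>
    ∑ k ∈ Finset.range a, 1 / (1 + ((X.tree.labelVertex k).length : ℝ)) with hu
  have hgap : ∀ i < X.m, gap u i = 1 / (1 + ((X.tree.labelVertex i).length : ℝ)) := by
    intro i hi
    rw [gap, dif_pos hi, hu]
    simp [Finset.sum_range_succ]
  refine ⟨fun x => u (X.partition.blk x), u, fun x => rfl, strictMono_of_gap_pos fun i => ?_,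
    fun i hi j hj hij => ?_⟩
  · rw [hgap i i.2]
    positivity
  · rw [hgap i hi, hgap j hj]
    constructor
    · have : ((X.tree.labelVertex j).length : ℝ) ≤ (X.tree.labelVertex i).length := by
        exact_mod_cast hij.length_le
      gcongr
    · intro h
      rw [one_div_le_one_div (by positivity) (by positivity)] at h
      exact PlaneTree.labelVertex_eq_of_length_eq hij (by exact_mod_cast le_of_add_le_add_left h)

theorem exists_of_vector (w₀ : Fin (d + 1) → ℝ) :
    ∃ X : PartitionLabeledTree d, X.IsInterior w₀ := by
  classical
  set s : Finset ℝ := Finset.univ.image w₀ with hs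
  have hne : s.Nonempty := Finset.univ_nonempty.image w₀
  obtain ⟨m, hm⟩ : ∃ m, s.card = m + 1 := ⟨s.card - 1, by have := hne.card_pos; omega⟩
  set u : Fin (m + 1) → ℝ := ⇑(s.orderEmbOfFin hm) with hu
  have hmem : ∀ x, ∃ a, u a = w₀ x := fun x => by
    have : w₀ x ∈ Set.range (s.orderEmbOfFin hm) := by
      rw [Finset.range_orderEmbOfFin]
      simp [hs]
    exact this
  have hmono : StrictMono u := (s.orderEmbOfFin hm).strictMono
  let S : OrderedPartition (d + 1) (m + 1) :=
    { block := fun a => Finset.univ.filter fun x => w₀ x = u a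
      nonempty := fun a => by
        have : u a ∈ s := Finset.orderEmbOfFin_mem s hm a
        obtain ⟨x, -, hx⟩ := Finset.mem_image.1 this
        exact ⟨x, by simpa using hx⟩
      disjoint := fun a b hab => by
        rw [Finset.disjoint_left]
        intro x hx hx'
        simp only [Finset.mem_filter, Finset.mem_univ, true_and] at hx hx'
        exact hab (hmono.injective (hx.symm.trans hx'))
      cover := fun x => by
        obtain ⟨a, ha⟩ := hmem x
        exact ⟨a, by simpa using ha.symm⟩ }
  obtain ⟨T, hT, hA, -⟩ := PlaneTree.exists_strictlyAdapted m (gap u)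
  refine ⟨⟨m, S, T, hT⟩, u, fun x => ?_, hmono, hA⟩
  have : x ∈ S.block (S.blk x) := S.mem_block_iff.2 rfl
  simpa [S] using this

end PartitionLabeledTree

/-! ### The fan of a finite family of functionals -/

section AbstractFan

variable {E ι : Type*} [AddCommGroup E] [Module ℝ E] (φ : ι → Module.Dual ℝ E)

/-- The indices of the members of the family `φ` that are maximal at `w`. -/
def maxSet (w : E) : Set ι := {s | ∀ t, φ t w ≤ φ s w}

/-- The points at which all members of the family that are maximal at `w₀` are maximal. -/
def maxCone (w₀ : E) : Set E := {w | maxSet φ w₀ ⊆ maxSet φ w}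

variable {φ}

theorem maxSet_zero (s : ι) : s ∈ maxSet φ 0 := fun t => by simp

theorem zero_mem_maxCone (w₀ : E) : 0 ∈ maxCone φ w₀ := fun s _ => maxSet_zero s

theorem eq_of_mem_maxSet {w : E} {s t : ι} (hs : s ∈ maxSet φ w) (ht : t ∈ maxSet φ w) :
    φ s w = φ t w := le_antisymm (ht s) (hs t)

theorem smul_mem_maxCone {w₀ w : E} (hw : w ∈ maxCone φ w₀) {c : ℝ} (hc : 0 ≤ c) :
    c • w ∈ maxCone φ w₀ := fun s hs t => by
  rw [map_smul, map_smul]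
  exact smul_le_smul_of_nonneg_left (hw hs t) hc

theorem maxSet_add {w w' : E} {s : ι} (hs : s ∈ maxSet φ w) (hs' : s ∈ maxSet φ w') :
    maxSet φ (w + w') = maxSet φ w ∩ maxSet φ w' := by
  ext t
  constructor
  · intro ht
    have h := ht s
    rw [map_add, map_add] at h
    have h1 := hs t
    have h2 := hs' t
    exact ⟨fun r => (hs r).trans (by linarith), fun r => (hs' r).trans (by linarith)⟩
  · rintro ⟨h1, h2⟩ r
    rw [map_add, map_add]
    exact add_le_add (h1 r) (h2 r)

theorem self_mem_maxCone (w : E) : w ∈ maxCone φ w := fun _ h => h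

theorem exists_smul_sub_mem_maxCone [Finite ι] {w₁ w : E} (hw : w ∈ maxCone φ w₁) :
    ∃ c : ℝ, c • w₁ - w ∈ maxCone φ w₁ := by
  cases nonempty_fintype ι
  refine ⟨∑ p : ι × ι, |φ p.1 w - φ p.2 w| / |φ p.1 w₁ - φ p.2 w₁|, fun s hs t => ?_⟩
  simp only [map_sub, map_smul, smul_eq_mul]
  rcases (hs t).eq_or_lt with h | h
  · have ht : t ∈ maxSet φ w₁ := fun r => (hs r).trans h.ge
    rw [h, eq_of_mem_maxSet (hw hs) (hw ht)]
  · have hpos : 0 < φ s w₁ - φ t w₁ := sub_pos.2 h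
    have hle : |φ s w - φ t w| / |φ s w₁ - φ t w₁| ≤
        ∑ p : ι × ι, |φ p.1 w - φ p.2 w| / |φ p.1 w₁ - φ p.2 w₁| :=
      Finset.single_le_sum (f := fun p : ι × ι => |φ p.1 w - φ p.2 w| / |φ p.1 w₁ - φ p.2 w₁|)
        (fun p _ => by positivity) (Finset.mem_univ (s, t))
    rw [abs_of_pos hpos, div_le_iff₀ hpos] at hle
    have := le_abs_self (φ s w - φ t w)
    linarith

theorem isNonemptyFace_maxCone_inter [Finite ι] [Nonempty ι] (w₀ w₀' : E) :
    IsNonemptyFace (maxCone φ w₀) (maxCone φ w₀ ∩ maxCone φ w₀') := by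
  classical
  cases nonempty_fintype ι
  obtain ⟨v, hv⟩ := Finite.exists_max fun s => φ s w₀
  refine ⟨⟨0, zero_mem_maxCone _, zero_mem_maxCone _⟩,
    ∑ t ∈ Finset.univ.filter fun t => t ∈ maxSet φ w₀', (φ t - φ v), ?_⟩
  have hnonpos : ∀ y ∈ maxCone φ w₀, ∀ t, (φ t - φ v) y ≤ 0 := fun y hy t => by
    have := hy hv t
    rw [LinearMap.sub_apply]
    linarith
  ext x
  simp only [Set.mem_inter_iff, Set.mem_ofPred_eq, LinearMap.sum_apply]
  constructor
  · rintro ⟨hx, hx'⟩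
    refine ⟨hx, fun y hy => ?_⟩
    have h0 : ∑ t ∈ Finset.univ.filter (fun t => t ∈ maxSet φ w₀'), (φ t - φ v) x = 0 := by
      refine Finset.sum_eq_zero fun t ht => ?_
      rw [Finset.mem_filter] at ht
      rw [LinearMap.sub_apply, eq_of_mem_maxSet (hx' ht.2) (hx hv), sub_self]
    rw [h0]
    exact Finset.sum_nonpos fun t _ => hnonpos y hy t
  · rintro ⟨hx, hmax⟩
    refine ⟨hx, fun t ht r => ?_⟩
    have h0 := hmax 0 (zero_mem_maxCone _)
    simp only [map_zero, Finset.sum_const_zero] at h0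
    have h1 := (Finset.sum_eq_zero_iff_of_nonpos fun t _ => hnonpos x hx t).1
      (le_antisymm (Finset.sum_nonpos fun t _ => hnonpos x hx t) h0) t (by simpa using ht)
    rw [LinearMap.sub_apply, sub_eq_zero] at h1
    rw [h1]
    exact hx hv r

theorem face_mem_range_maxCone [Finite ι] [Nonempty ι] {w₀ : E} {F : Set E}
    (hF : IsNonemptyFace (maxCone φ w₀) F) : F ∈ Set.range (maxCone φ) := by
  obtain ⟨⟨x₀, hx₀⟩, l, hl⟩ := hF
  have hx₀' := hx₀
  rw [hl] at hx₀'
  have hl0 : l x₀ = 0 := by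
    have h1 := hx₀'.2 0 (zero_mem_maxCone _)
    have h2 := hx₀'.2 ((2 : ℝ) • x₀) (smul_mem_maxCone hx₀'.1 (by norm_num))
    rw [map_zero] at h1
    rw [map_smul, smul_eq_mul] at h2
    linarith
  have hle : ∀ y ∈ maxCone φ w₀, l y ≤ 0 := fun y hy => hl0 ▸ hx₀'.2 y hy
  have hF : ∀ x, x ∈ F ↔ x ∈ maxCone φ w₀ ∧ l x = 0 := fun x => by
    rw [hl]
    constructor
    · rintro ⟨h1, h2⟩
      exact ⟨h1, le_antisymm (hle x h1) (by simpa using h2 0 (zero_mem_maxCone _))⟩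
    · rintro ⟨h1, h2⟩
      exact ⟨h1, fun y hy => h2 ▸ hle y hy⟩
  obtain ⟨w₁, hw₁, hmin⟩ := exists_minimalFor_of_wellFoundedLT (· ∈ F) (maxSet φ) ⟨x₀, hx₀⟩
  have hw₁' := (hF w₁).1 hw₁
  refine ⟨w₁, Set.Subset.antisymm (fun w hw => ?_) fun w hw => ?_⟩
  · have hwC : w ∈ maxCone φ w₀ := fun _ hs => hw (hw₁'.1 hs)
    obtain ⟨c, hc⟩ := exists_smul_sub_mem_maxCone hw
    have h1 := hle _ fun _ hs => hc (hw₁'.1 hs)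
    rw [map_sub, map_smul, hw₁'.2, smul_zero] at h1
    exact (hF w).2 ⟨hwC, le_antisymm (hle w hwC) (by linarith)⟩
  · have hw' := (hF w).1 hw
    obtain ⟨v, hv⟩ := Finite.exists_max fun s => φ s w₀
    have hadd := maxSet_add (hw₁'.1 hv) (hw'.1 hv)
    have hmem : w₁ + w ∈ F := by
      refine (hF _).2 ⟨fun s hs => ?_, by rw [map_add, hw₁'.2, hw'.2, add_zero]⟩
      rw [hadd]
      exact ⟨hw₁'.1 hs, hw'.1 hs⟩
    have := hmin hmem (by rw [hadd]; exact Set.inter_subset_left)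
    rw [hadd] at this
    exact fun _ hs => (this hs).2

theorem isPolyhedralCone_maxCone [Finite ι] (w₀ : E) : IsPolyhedralCone (maxCone φ w₀) := by
  classical
  cases nonempty_fintype ι
  refine ⟨Finset.univ.image fun p : ι × ι => if p.1 ∈ maxSet φ w₀ then φ p.1 - φ p.2 else 0, ?_⟩
  ext w
  rw [Set.mem_ofPred_eq, Finset.forall_mem_image]
  constructor
  · rintro hw ⟨s, t⟩ -
    split_ifs with hs
    · exact sub_nonneg.2 (hw hs t)
    · simp
  · intro h s hs t
    have := h (Finset.mem_univ (s, t))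
    rw [if_pos hs] at this
    exact sub_nonneg.1 this

theorem isFan_range_maxCone [Finite ι] [Nonempty ι] : IsFan (Set.range (maxCone φ)) where
  finite := by
    refine (Set.finite_range fun A : Set ι => {w | A ⊆ maxSet φ w}).subset ?_
    rintro _ ⟨w, rfl⟩
    exact ⟨maxSet φ w, rfl⟩
  polyhedral := by
    rintro _ ⟨w, rfl⟩
    exact isPolyhedralCone_maxCone w
  face_mem := by
    rintro _ ⟨w, rfl⟩ F hF
    exact face_mem_range_maxCone hF
  inter_face := by
    rintro _ ⟨w, rfl⟩ _ ⟨w', rfl⟩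
    refine ⟨isNonemptyFace_maxCone_inter w w', ?_⟩
    rw [Set.inter_comm]
    exact isNonemptyFace_maxCone_inter w' w

theorem isCompleteFan_range_maxCone : IsCompleteFan (Set.range (maxCone φ)) :=
  Set.eq_univ_of_forall fun w => ⟨_, ⟨w, rfl⟩, self_mem_maxCone w⟩

theorem mem_convexHull_maximizers {S : Set E} {l : Module.Dual ℝ E} {M : ℝ}
    (hS : ∀ s ∈ S, l s ≤ M) {x : E} (hx : x ∈ convexHull ℝ S) (hM : M ≤ l x) :
    x ∈ convexHull ℝ {s ∈ S | l s = M} := by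
  set K := convexHull ℝ {s ∈ S | l s = M} with hK
  have hlK : ∀ y ∈ K, l y = M := fun y hy => by
    have : K ⊆ {y | l y = M} :=
      convexHull_min (fun s hs => hs.2) (convex_hyperplane l.isLinear M)
    exact this hy
  have hconv : Convex ℝ {y | l y < M ∨ y ∈ K} := by
    intro y hy z hz a b ha hb hab
    have hy' : l y ≤ M := hy.elim le_of_lt fun h => (hlK y h).le
    have hz' : l z ≤ M := hz.elim le_of_lt fun h => (hlK z h).le
    rcases ha.eq_or_lt with rfl | ha'
    · obtain rfl : b = 1 := by linarith
      simpa using hz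
    rcases hb.eq_or_lt with rfl | hb'
    · obtain rfl : a = 1 := by linarith
      simpa using hy
    rcases hy with hy | hy
    · left
      rw [map_add, map_smul, map_smul, smul_eq_mul, smul_eq_mul]
      calc a * l y + b * l z < a * M + b * M := add_lt_add_of_lt_of_le
            (mul_lt_mul_of_pos_left hy ha') (mul_le_mul_of_nonneg_left hz' hb)
        _ = M := by rw [← add_mul, hab, one_mul]
    rcases hz with hz | hz
    · left
      rw [map_add, map_smul, map_smul, smul_eq_mul, smul_eq_mul]
      calc a * l y + b * l z < a * M + b * M := add_lt_add_of_le_of_lt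
            (mul_le_mul_of_nonneg_left hy' ha) (mul_lt_mul_of_pos_left hz hb')
        _ = M := by rw [← add_mul, hab, one_mul]
    · exact Or.inr (convex_convexHull ℝ _ hy hz ha hb hab)
  have hsub : convexHull ℝ S ⊆ {y | l y < M ∨ y ∈ K} :=
    convexHull_min (fun s hs => (hS s hs).lt_or_eq.imp_right fun h =>
      subset_convexHull ℝ _ ⟨hs, h⟩) hconv
  exact (hsub hx).resolve_left hM.not_gt

end AbstractFan

/-! ### The nested permuto-associahedron -/

theorem pairing_mk {d : ℕ} (w : Fin (d + 1) → ℝ) (x : V d) :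
    pairing d (Submodule.Quotient.mk w) x = ∑ i, w i * x.1 i := rfl

theorem mem_V {d : ℕ} {x : Fin (d + 1) → ℝ} : x ∈ V d ↔ ∑ i, x i = 0 := Iff.rfl

theorem sub_mem_V {d : ℕ} {α x y : Fin (d + 1) → ℝ} (hx : x ∈ U α) (hy : y ∈ U α) :
    x - y ∈ V d := by
  have hx : ∑ i, x i = ∑ i, α i := hx
  have hy : ∑ i, y i = ∑ i, α i := hy
  simp [mem_V, Finset.sum_sub_distrib, hx, hy]

theorem mk_mem_ncone_iff {d : ℕ} {α : Fin (d + 1) → ℝ} {F P : Set (Fin (d + 1) → ℝ)}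
    (hF : F ⊆ U α) (hP : P ⊆ U α) (w : Fin (d + 1) → ℝ) :
    (Submodule.Quotient.mk w : W d) ∈ ncone F P ↔
      ∀ y ∈ F, ∀ y' ∈ P, ∑ i, w i * y' i ≤ ∑ i, w i * y i := by
  have key : ∀ y y' : Fin (d + 1) → ℝ,
      0 ≤ ∑ i, w i * (y - y') i ↔ ∑ i, w i * y' i ≤ ∑ i, w i * y i := fun y y' => by
    simp [mul_sub, Finset.sum_sub_distrib]
  constructor
  · intro h y hy y' hy'
    have := h y hy y' hy' (sub_mem_V (hF hy) (hP hy'))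
    rw [pairing_mk] at this
    exact (key y y').1 this
  · intro h y hy y' hy' hV
    rw [pairing_mk]
    exact (key y y').2 (h y hy y' hy')

/-- The functional on `ℝ^(d+1)` given by the dot product with `w`. -/
def dotFunctional {d : ℕ} (w : Fin (d + 1) → ℝ) : Module.Dual ℝ (Fin (d + 1) → ℝ) where
  toFun x := ∑ i, w i * x i
  map_add' x y := by simp [mul_add, Finset.sum_add_distrib]
  map_smul' c x := by simp [Finset.mul_sum, mul_left_comm]

theorem dotFunctional_apply {d : ℕ} (w x : Fin (d + 1) → ℝ) :
    dotFunctional w x = ∑ i, w i * x i := rfl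

theorem exists_eq_dotFunctional {d : ℕ} (l : Module.Dual ℝ (Fin (d + 1) → ℝ)) :
    ∃ w, l = dotFunctional w := by
  refine ⟨fun i => l fun j => if i = j then 1 else 0, LinearMap.ext fun x => ?_⟩
  rw [LinearMap.pi_apply_eq_sum_univ l x, dotFunctional_apply]
  exact Finset.sum_congr rfl fun i _ => mul_comm _ _

section Polytope

variable {d : ℕ} {α : Fin (d + 1) → ℝ} {β : Fin d → ℝ}

theorem vpt_mem_U (π : Equiv.Perm (Fin (d + 1))) (T : PlaneTree) : vpt α β π T ∈ U α := by
  have := sum_mul_vpt α β π T 1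
  have hg : ∀ i, gap ((1 : Fin (d + 1) → ℝ) ∘ π.symm) i = 0 := fun i => by simp [gap]
  simp only [hg, Pi.one_apply, one_mul, mul_one, mul_zero, Finset.sum_const_zero, add_zero] at this
  exact this

theorem convex_U : Convex ℝ (U α) := by
  have h := convex_hyperplane (dotFunctional (1 : Fin (d + 1) → ℝ)).isLinear (∑ i, α i)
  simp only [dotFunctional_apply, Pi.one_apply, one_mul] at h
  exact h

theorem permAssoPoints_subset_U : permAssoPoints α β ⊆ U α := by
  rintro _ ⟨π, T, -, rfl⟩
  exact vpt_mem_U π T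

theorem permAsso_subset_U : permAsso α β ⊆ U α :=
  convexHull_min permAssoPoints_subset_U convex_U

theorem finite_permAssoPoints : (permAssoPoints α β).Finite := by
  refine ((Set.finite_univ (α := Equiv.Perm (Fin (d + 1)))).image2
    (fun π c => ∑ i, α i • (Pi.single (π.symm i) 1 : Fin (d + 1) → ℝ) + ∑ i, c i • fvec π i)
    (finite_treeCoeff β)).subset ?_
  rintro _ ⟨π, T, hT, rfl⟩
  exact ⟨π, trivial, _, ⟨T, hT, rfl⟩, rfl⟩

theorem permAssoPoints_nonempty : (permAssoPoints α β).Nonempty := by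
  obtain ⟨T, hT, -⟩ := exists_adapted (d := d) 0 0
  exact ⟨_, 1, T, hT, rfl⟩

theorem dotFunctional_le_of_mem (hαβ : IsTreeAppropriate α β) {x : Fin (d + 1) → ℝ}
    (hx : x ∈ permAsso α β) (w : Fin (d + 1) → ℝ) :
    dotFunctional w x ≤ supportValue α β w := by
  have : permAsso α β ⊆ {x | dotFunctional w x ≤ supportValue α β w} := by
    refine convexHull_min ?_ (convex_halfSpace_le (dotFunctional w).isLinear _)
    rintro _ ⟨π, T, hT, rfl⟩
    exact (sum_mul_vpt_le hαβ π hT w).1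
  exact this hx

theorem forall_le_vpt_iff (hαβ : IsTreeAppropriate α β) {S : Set (Fin (d + 1) → ℝ)}
    (hS : permAssoPoints α β ⊆ S) (hS' : S ⊆ permAsso α β) (π : Equiv.Perm (Fin (d + 1)))
    {T : PlaneTree} (hT : T ∈ treesInternal d d) (w : Fin (d + 1) → ℝ) :
    (∀ y ∈ S, dotFunctional w y ≤ dotFunctional w (vpt α β π T)) ↔ SortedAdapted w π T := by
  rw [← (sum_mul_vpt_le hαβ π hT w).2, ← dotFunctional_apply]
  constructor
  · intro h
    refine le_antisymm (sum_mul_vpt_le hαβ π hT w).1 ?_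
    obtain ⟨π', T', hT', h'⟩ := exists_sortedAdapted w
    rw [← (sum_mul_vpt_le hαβ π' hT' w).2.2 h']
    exact h _ (hS ⟨π', T', hT', rfl⟩)
  · intro h y hy
    rw [h]
    exact dotFunctional_le_of_mem hαβ (hS' hy) w

/-- The functionals on `W_d` given by the points `v_{π,T}`. -/
def pointFunctional (α : Fin (d + 1) → ℝ) (β : Fin d → ℝ) (x : permAssoPoints α β) :
    Module.Dual ℝ (W d) :=
  (pairing d).flip ⟨x.1 - α, sub_mem_V (α := α) (permAssoPoints_subset_U x.2) rfl⟩

theorem pointFunctional_mk (x : permAssoPoints α β) (w : Fin (d + 1) → ℝ) :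
    pointFunctional α β x (Submodule.Quotient.mk w) = dotFunctional w x - dotFunctional w α := by
  rw [← map_sub]
  rfl

theorem mem_maxSet_pointFunctional_iff {x : permAssoPoints α β} {w : Fin (d + 1) → ℝ} :
    x ∈ maxSet (pointFunctional α β) (Submodule.Quotient.mk w) ↔
      ∀ y ∈ permAssoPoints α β, dotFunctional w y ≤ dotFunctional w x := by
  simp [maxSet, pointFunctional_mk]

theorem mk_mem_maxCone_iff (hαβ : IsTreeAppropriate α β) (w₀ w : Fin (d + 1) → ℝ) :
    (Submodule.Quotient.mk w : W d) ∈ maxCone (pointFunctional α β) (Submodule.Quotient.mk w₀) ↔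
      ∀ π, ∀ T ∈ treesInternal d d, SortedAdapted w₀ π T → SortedAdapted w π T := by
  have key : ∀ (w : Fin (d + 1) → ℝ) π T, T ∈ treesInternal d d → _ := fun w π T hT =>
    forall_le_vpt_iff hαβ subset_rfl (subset_convexHull ℝ _) π hT w
  constructor
  · intro h π T hT h₀
    have := @h ⟨_, π, T, hT, rfl⟩ (mem_maxSet_pointFunctional_iff.2 ((key w₀ π T hT).2 h₀))
    exact (key w π T hT).1 (mem_maxSet_pointFunctional_iff.1 this)
  · rintro h ⟨_, π, T, hT, rfl⟩ hx
    exact mem_maxSet_pointFunctional_iff.2 ((key w π T hT).2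
      (h π T hT ((key w₀ π T hT).1 (mem_maxSet_pointFunctional_iff.1 hx))))

theorem PartitionLabeledTree.cone_eq_maxCone (hαβ : IsTreeAppropriate α β)
    {X : PartitionLabeledTree d} {w₀ : Fin (d + 1) → ℝ} (hX : X.IsInterior w₀) :
    X.cone = maxCone (pointFunctional α β) (Submodule.Quotient.mk w₀) := by
  ext w
  obtain ⟨w, rfl⟩ := Submodule.Quotient.mk_surjective _ w
  rw [mk_mem_maxCone_iff hαβ, X.mk_mem_cone_iff_forall hX]

theorem nestedLodayFan_eq_range_maxCone (hαβ : IsTreeAppropriate α β) :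
    nestedLodayFan d = Set.range (maxCone (pointFunctional α β)) := by
  ext C
  constructor
  · rintro ⟨X, rfl⟩
    obtain ⟨w₀, hX⟩ := X.exists_isInterior
    exact ⟨_, (X.cone_eq_maxCone hαβ hX).symm⟩
  · rintro ⟨w₀, rfl⟩
    obtain ⟨w₀, rfl⟩ := Submodule.Quotient.mk_surjective _ w₀
    obtain ⟨X, hX⟩ := PartitionLabeledTree.exists_of_vector w₀
    exact ⟨X, X.cone_eq_maxCone hαβ hX⟩

theorem exists_dotFunctional_eq_supportValue (hαβ : IsTreeAppropriate α β)
    (w : Fin (d + 1) → ℝ) : ∃ x ∈ permAssoPoints α β, dotFunctional w x = supportValue α β w := by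
  obtain ⟨π, T, hT, h⟩ := exists_sortedAdapted w
  exact ⟨_, ⟨π, T, hT, rfl⟩, (sum_mul_vpt_le hαβ π hT w).2.2 h⟩

theorem ncone_face_eq_maxCone (hαβ : IsTreeAppropriate α β) (w₀ : Fin (d + 1) → ℝ) :
    ncone {x | x ∈ permAsso α β ∧ ∀ y ∈ permAsso α β, dotFunctional w₀ y ≤ dotFunctional w₀ x}
      (permAsso α β) = maxCone (pointFunctional α β) (Submodule.Quotient.mk w₀) := by
  ext w
  obtain ⟨w, rfl⟩ := Submodule.Quotient.mk_surjective _ w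
  rw [mk_mem_maxCone_iff hαβ,
    mk_mem_ncone_iff (α := α) (fun x hx => permAsso_subset_U hx.1) permAsso_subset_U]
  have key : ∀ (w : Fin (d + 1) → ℝ) π T, T ∈ treesInternal d d → _ := fun w π T hT =>
    forall_le_vpt_iff hαβ (S := permAsso α β) (subset_convexHull ℝ _) subset_rfl π hT w
  constructor
  · intro h π T hT h₀
    exact (key w π T hT).1 (h _ ⟨subset_convexHull ℝ _ ⟨π, T, hT, rfl⟩, (key w₀ π T hT).2 h₀⟩)
  · rintro h y ⟨hy, hy'⟩ y' hy''
    obtain ⟨x, hx, hxw⟩ := exists_dotFunctional_eq_supportValue hαβ w₀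
    have hyM : supportValue α β w₀ ≤ dotFunctional w₀ y :=
      hxw ▸ hy' x (subset_convexHull ℝ _ hx)
    have hmem := mem_convexHull_maximizers
      (fun s hs => dotFunctional_le_of_mem hαβ (subset_convexHull ℝ _ hs) w₀) hy hyM
    have hsub : convexHull ℝ {s ∈ permAssoPoints α β | dotFunctional w₀ s = supportValue α β w₀} ⊆
        {z | dotFunctional w z = supportValue α β w} := by
      refine convexHull_min ?_ (convex_hyperplane (dotFunctional w).isLinear _)
      rintro _ ⟨⟨π, T, hT, rfl⟩, hs⟩
      exact (sum_mul_vpt_le hαβ π hT w).2.2 (h π T hT ((sum_mul_vpt_le hαβ π hT w₀).2.1 hs))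
    have hyw : dotFunctional w y = supportValue α β w := hsub hmem
    have := dotFunctional_le_of_mem hαβ hy'' w
    rw [← hyw] at this
    exact this

theorem normalFan_permAsso (hαβ : IsTreeAppropriate α β) :
    normalFan (permAsso α β) = nestedLodayFan d := by
  rw [nestedLodayFan_eq_range_maxCone hαβ]
  ext C
  constructor
  · rintro ⟨F, ⟨-, l, rfl⟩, rfl⟩
    obtain ⟨w₀, rfl⟩ := exists_eq_dotFunctional l
    exact ⟨_, (ncone_face_eq_maxCone hαβ w₀).symm⟩
  · rintro ⟨w₀, rfl⟩
    obtain ⟨w₀, rfl⟩ := Submodule.Quotient.mk_surjective _ w₀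
    refine ⟨_, ⟨?_, dotFunctional w₀, rfl⟩, (ncone_face_eq_maxCone hαβ w₀).symm⟩
    obtain ⟨x, hx, hxw⟩ := exists_dotFunctional_eq_supportValue hαβ w₀
    exact ⟨x, subset_convexHull ℝ _ hx, fun y hy => hxw ▸ dotFunctional_le_of_mem hαβ hy w₀⟩

theorem permCone_eq_ncone (hαβ : IsTreeAppropriate α β) (π : Equiv.Perm (Fin (d + 1)))
    {T : PlaneTree} (hT : T ∈ treesInternal d d) :
    permCone π T hT.1 = ncone {vpt α β π T} (permAsso α β) := by
  ext w
  obtain ⟨w, rfl⟩ := Submodule.Quotient.mk_surjective _ w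
  rw [mk_mem_permCone_iff, mk_mem_ncone_iff (α := α)
    (Set.singleton_subset_iff.2 (vpt_mem_U π T)) permAsso_subset_U]
  simp only [Set.mem_singleton_iff, forall_eq]
  exact (forall_le_vpt_iff hαβ (subset_convexHull ℝ _) subset_rfl π hT w).symm

theorem vpt_eq_of_isInterior {π π' : Equiv.Perm (Fin (d + 1))} {T T' : PlaneTree}
    (hT : T ∈ treesInternal d d) (hT' : T' ∈ treesInternal d d) {w₀ : Fin (d + 1) → ℝ}
    (hw₀ : PartitionLabeledTree.IsInterior ⟨d, permPartition π, T, hT.1⟩ w₀)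
    (h : SortedAdapted w₀ π' T') : vpt α β π' T' = vpt α β π T := by
  obtain ⟨u, hu, hmono, hA⟩ := hw₀
  dsimp only at u hu hmono hA
  rw [OrderedPartition.blk_permPartition] at hu
  obtain rfl : w₀ = u ∘ π := funext hu
  have hπ : π'.symm.trans π = 1 := by
    rw [← Equiv.Perm.monotone_iff]
    intro i j hij
    exact hmono.le_iff_le.1 (h.1 hij)
  obtain rfl : π' = π := by
    ext x
    have := congrArg (fun σ : Equiv.Perm (Fin (d + 1)) => σ (π' x)) hπ
    simp at this
    rw [this]
  have hu' : (u ∘ π') ∘ π'.symm = u := by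
    funext i
    simp
  have hA' := h.2
  rw [hu'] at hA'
  have hc : treeCoeff β T = treeCoeff β T' := by
    refine treeCoeff_congr β hT hT' fun i hi j hj hij => ?_
    obtain ⟨m, h1, h2, h3⟩ := PlaneTree.exists_labelLE_of_le hT.1
      (show min i j ≤ max i j by omega) (by omega)
    have hjm := h3 j (by omega) (by omega)
    have hmj := (hA j hj m (by omega) hjm).2 (hA' m (by omega) j hj
      (PlaneTree.labelLE_of_between hT'.1 hi hj hij h1 h2))
    exact PlaneTree.labelLE_trans (h3 i (by omega) (by omega)) hmj
  rw [vpt, vpt, hc]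

theorem vertexSet_permAsso (hαβ : IsTreeAppropriate α β) :
    vertexSet (permAsso α β) = permAssoPoints α β := by
  ext v
  constructor
  · rintro ⟨-, l, hl⟩
    have hv : v ∈ permAsso α β ∧ ∀ y ∈ permAsso α β, l y ≤ l v := by
      have : v ∈ ({v} : Set (Fin (d + 1) → ℝ)) := rfl
      rwa [hl] at this
    have hmem := mem_convexHull_maximizers
      (fun s hs => hv.2 s (subset_convexHull ℝ _ hs)) hv.1 le_rfl
    obtain ⟨s, hs, hsl⟩ := convexHull_nonempty_iff.1 ⟨v, hmem⟩
    have : s ∈ ({v} : Set (Fin (d + 1) → ℝ)) := by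
      rw [hl]
      exact ⟨subset_convexHull ℝ _ hs, fun y hy => hsl ▸ hv.2 y hy⟩
    rwa [← Set.mem_singleton_iff.1 this]
  · rintro ⟨π, T, hT, rfl⟩
    refine ⟨Set.singleton_nonempty _, ?_⟩
    obtain ⟨w₀, hw₀⟩ :=
      PartitionLabeledTree.exists_isInterior ⟨d, permPartition π, T, hT.1⟩
    have hv : dotFunctional w₀ (vpt α β π T) = supportValue α β w₀ := by
      obtain ⟨π', T', hT', h⟩ := exists_sortedAdapted w₀
      rw [← vpt_eq_of_isInterior hT hT' hw₀ h]
      exact (sum_mul_vpt_le hαβ π' hT' w₀).2.2 h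
    refine ⟨dotFunctional w₀, Set.Subset.antisymm ?_ ?_⟩
    · rintro _ rfl
      exact ⟨subset_convexHull ℝ _ ⟨π, T, hT, rfl⟩,
        fun y hy => hv ▸ dotFunctional_le_of_mem hαβ hy w₀⟩
    · rintro x ⟨hx, hmax⟩
      have hmem := mem_convexHull_maximizers
        (fun s hs => dotFunctional_le_of_mem hαβ (subset_convexHull ℝ _ hs) w₀) hx
        (hv ▸ hmax _ (subset_convexHull ℝ _ ⟨π, T, hT, rfl⟩))
      refine convexHull_min ?_ (convex_singleton _) hmem
      rintro _ ⟨⟨π', T', hT', rfl⟩, hs⟩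
      exact vpt_eq_of_isInterior hT hT' hw₀ ((sum_mul_vpt_le hαβ π' hT' w₀).2.1 hs)

theorem affineSpan_permAsso (hαβ : IsTreeAppropriate α β) :
    (affineSpan ℝ (permAsso α β) : Set (Fin (d + 1) → ℝ)) = U α := by
  classical
  rw [permAsso, affineSpan_convexHull]
  refine Set.Subset.antisymm ?_ fun x hx => ?_
  · have hU : (AffineSubspace.mk' α (V d) : Set (Fin (d + 1) → ℝ)) = U α := by
      ext x
      simp [AffineSubspace.mem_mk', mem_V, Finset.sum_sub_distrib, U, sub_eq_zero]
    rw [← hU]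
    exact SetLike.coe_subset_coe.2 (affineSpan_le.2 (hU ▸ permAssoPoints_subset_U))
  · obtain ⟨T, hT, -⟩ := exists_adapted (d := d) 0 0
    have hv : ∀ π, vpt α β π T ∈ permAssoPoints α β := fun π => ⟨π, T, hT, rfl⟩
    have hc : StrictMono (vpt α β 1 T) := hαβ.strictMono_coeff T hT 1
    have happ : ∀ π x, vpt α β π T x = vpt α β 1 T (π x) := fun π x => by
      rw [← vpt_apply_symm α β π T (π x), Equiv.symm_apply_apply]
    have hroot : ∀ a b : Fin (d + 1),
        (Pi.single a 1 - Pi.single b 1 : Fin (d + 1) → ℝ) ∈ vectorSpan ℝ (permAssoPoints α β) := by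
      intro a b
      rcases eq_or_ne a b with rfl | hab
      · simp
      have h1 := vsub_mem_vectorSpan ℝ (hv 1) (hv (Equiv.swap a b))
      have h2 : vpt α β 1 T -ᵥ vpt α β (Equiv.swap a b) T = (vpt α β 1 T a - vpt α β 1 T b) •
          (Pi.single a 1 - Pi.single b 1 : Fin (d + 1) → ℝ) := by
        funext x
        rw [vsub_eq_sub, Pi.sub_apply, happ (Equiv.swap a b) x]
        rcases eq_or_ne x a with rfl | hxa
        · simp [hab]
        rcases eq_or_ne x b with rfl | hxb
        · simp [hab.symm]
        · simp [Equiv.swap_apply_of_ne_of_ne hxa hxb, hxa, hxb]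
      rw [h2] at h1
      exact (Submodule.smul_mem_iff _ (sub_ne_zero.2 fun h => hab (hc.injective h))).1 h1
    have hVs : ∀ y ∈ V d, y ∈ vectorSpan ℝ (permAssoPoints α β) := by
      intro y hy
      have : y = ∑ i, y i • (Pi.single i 1 - Pi.single 0 1 : Fin (d + 1) → ℝ) := by
        simp only [smul_sub, Finset.sum_sub_distrib, ← Finset.sum_smul, mem_V.1 hy, zero_smul,
          sub_zero]
        funext j
        simp [Finset.sum_apply, Pi.single_apply]
      rw [this]
      exact Submodule.sum_mem _ fun i _ => Submodule.smul_mem _ _ (hroot i 0)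
    have h3 := AffineSubspace.vadd_mem_of_mem_direction
      (direction_affineSpan ℝ (permAssoPoints α β) ▸ hVs _ (sub_mem_V hx (vpt_mem_U (β := β) 1 T)))
      (mem_affineSpan ℝ (hv 1))
    simpa using h3

end Polytope

end NestedPermAsso

theorem proposition6p4 (d : ℕ) (α : Fin (d + 1) → ℝ) (β : Fin d → ℝ)
    (hαβ : IsTreeAppropriate α β) :
    ((affineSpan ℝ (permAsso α β) : Set (Fin (d + 1) → ℝ)) = U α ∧
      vertexSet (permAsso α β) = permAssoPoints α β) ∧
    (∀ (π : Equiv.Perm (Fin (d + 1))) (T : PlaneTree) (hT : T ∈ treesInternal d d),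
      permCone π T hT.1 = ncone {vpt α β π T} (permAsso α β)) ∧
    (normalFan (permAsso α β) = nestedLodayFan d ∧
      IsFan (nestedLodayFan d) ∧ IsCompleteFan (nestedLodayFan d) ∧
      IsProjective (nestedLodayFan d)) := by
  have hfin : Finite (permAssoPoints α β) := finite_permAssoPoints
  have hne : Nonempty (permAssoPoints α β) := permAssoPoints_nonempty.to_subtype
  refine ⟨⟨affineSpan_permAsso hαβ, vertexSet_permAsso hαβ⟩,
    fun π T hT => permCone_eq_ncone hαβ π hT, normalFan_permAsso hαβ, ?_, ?_, ?_⟩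
  · rw [nestedLodayFan_eq_range_maxCone hαβ]
    exact isFan_range_maxCone
  · rw [nestedLodayFan_eq_range_maxCone hαβ]
    exact isCompleteFan_range_maxCone
  · refine ⟨α, finite_permAssoPoints.toFinset (α := Fin (d + 1) → ℝ) (s := permAssoPoints α β),
      ?_, ?_, ?_⟩
    · simpa using permAssoPoints_nonempty
    · simpa using permAssoPoints_subset_U
    · rw [Set.Finite.coe_toFinset]
      exact normalFan_permAsso hαβ
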